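/- Notation. For $l\ge 0$ let $\mathbf C[X_1,X_2]_l$ be the space of homogeneous polynomials of degree $l$, on which $A\in GL_2(\mathbf C)$ acts by $(\sigma_l(A)p)(X)=p(XA)$, $X=(X_1,X_2)$ a row vector. Write $Z=\begin{pmatrix} z_1&z_{12}\\ z_{12}&z_2\end{pmatrix}$ for the points of Siegel's upper half space $\mathbf H_2$. For $F:\mathbf H_2\to\mathbf C[X_1,X_2]_l$ and $M=\begin{pmatrix}A&B\\C&D\end{pmatrix}\in Sp(2,\mathbf R)$ put $$(F|_{k,l}M)(Z)=\det(CZ+D)^{-k}\,\sigma_l(CZ+D)^{-1}\,F\bigl((AZ+B)(CZ+D)^{-1}\bigr).$$ Let $|_w^{z_i}$ be the usual weight $w$ slash operator of $SL(2,\mathbf R)$ in the variable $z_i\in\mathbf H$, and let $M_1\mapsto M_1^\uparrow$, $M_2\mapsto M_2^\downarrow$ be the two factors of the standard embedding $SL(2)\times SL(2)\to Sp(2)$, $$\begin{pmatrix} \alpha&\beta\\ \gamma&\delta\end{pmatrix}^{\uparrow}\begin{pmatrix} \alpha'&\beta'\\ \gamma'&\delta'\end{pmatrix}^{\downarrow}=\begin{pmatrix}\alpha&0&\beta&0\\0&\alpha'&0&\beta'\\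 \gamma&0&\delta&0\\0&\gamma'&0&\delta'\end{pmatrix}.$$ Write $\partial/\partial z=\frac12(\partial/\partial x-i\,\partial/\partial y)$. Proposition 2.7. Let $k\ge 2$, $r\ge 0$ and $l=a+b$ with integers $a,b\ge 0$. There is a polynomial $P$ in three variables with complex coefficients, homogeneous of degree $r$ and depending only on $k,r,a,b$, with the following properties. For a $C^\infty$ function $F:\mathbf H_2\to\mathbf C[X_1,X_2]_l$ let $\mathcal D F=\mathcal D^r_{k,a,b}F:\mathbf H\times\mathbf H\to\mathbf C$ be defined by $$(\mathcal D F)(z_1,z_2)=\text{coefficient of }X_1^{a+r}X_2^{b+r}\text{ in }\;P\Bigl(X_1^2\tfrac{\partial}{\partial z_1},\,X_1X_2\tfrac{\partial}{\partial z_{12}},\,X_2^2\tfrac{\partial}{\partial z_2}\Bigr)F\;\Big|_{z_{12}=0}$$ (equivalently, one may regard $\mathcal DF\cdot X_1^{a+r}X_2^{b+r}$ as a $\mathbf C\cdot X_1^{a+r}X_2^{b+r}$-valued function). Then: (i) $\mathcal D$ is not zero: $\mathcal DF\ne0$ for some holomorphic $F$. (ii) $\mathcal D$ maps $C^\infty$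 functions on $\mathbf H_2$ to $C^\infty$ functions on $\mathbf H\times\mathbf H$, and holomorphic functions to holomorphic functions. (iii) For all $C^\infty$ functions $F:\mathbf H_2\to\mathbf C[X_1,X_2]_l$ and all $M_1,M_2\in SL(2,\mathbf R)$, $$\mathcal D\bigl(F|_{k,l}M_1^{\uparrow}M_2^{\downarrow}\bigr)=(\mathcal DF)\,|^{z_1}_{k+a+r}M_1\,|^{z_2}_{k+b+r}M_2 .$$ -/

import Mathlib

open Matrix MvPolynomial
open scoped ModularForm UpperHalfPlane MatrixGroups ContDiff

noncomputable section

namespace SiegelDiff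

/-- `ℂ[X₁, X₂]_l`, the homogeneous polynomials of degree `l` in two variables. -/
abbrev HomPoly (l : ℕ) : Type := homogeneousSubmodule (Fin 2) ℂ l

/-- The exponent of the monomial `X₁ ^ i * X₂ ^ j`. -/
def bideg (i j : ℕ) : Fin 2 →₀ ℕ := Finsupp.single 0 i + Finsupp.single 1 j

/-- The linear substitution `p(X) ↦ p(X A)`, where `X = (X₁, X₂)` is a row vector. -/
def substRow (A : Matrix (Fin 2) (Fin 2) ℂ) :
    MvPolynomial (Fin 2) ℂ →ₐ[ℂ] MvPolynomial (Fin 2) ℂ :=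
  aeval fun j => ∑ i, X i * C (A i j)

lemma substRow_isHomogeneous {l : ℕ} (A : Matrix (Fin 2) (Fin 2) ℂ)
    {p : MvPolynomial (Fin 2) ℂ} (hp : p.IsHomogeneous l) :
    (substRow A p).IsHomogeneous l := by
  have h := hp.aeval (S := ℂ) (n := 1) (fun j => ∑ i, X i * C (A i j)) (fun j =>
    IsHomogeneous.sum _ _ _ fun i _ => by
      simpa using (isHomogeneous_X ℂ i).mul (isHomogeneous_C (Fin 2) (A i j)))
  simpa [substRow] using h

/-- The `l`-th symmetric power representation of `GL₂(ℂ)` on `ℂ[X₁, X₂]_l`,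
`(σ_l(A) p)(X) = p(X A)`. -/
def symPow (l : ℕ) (A : Matrix (Fin 2) (Fin 2) ℂ) : HomPoly l →ₗ[ℂ] HomPoly l :=
  (substRow A).toLinearMap.restrict fun _ hp => substRow_isHomogeneous A hp

/-- The symmetric matrix with coordinates `(z₁, z₁₂, z₂)`. -/
def symMat (x : Fin 3 → ℂ) : Matrix (Fin 2) (Fin 2) ℂ := !![x 0, x 1; x 1, x 2]

/-- Siegel's upper half space of degree two. -/
def siegelH2 : Set (Matrix (Fin 2) (Fin 2) ℂ) :=
  {Z | Z.IsSymm ∧ (Z.map Complex.im).PosDef}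

/-- Siegel's upper half space in the coordinates `(z₁, z₁₂, z₂)`, an open subset of `ℂ³`. -/
def siegelCoord : Set (Fin 3 → ℂ) := {x | symMat x ∈ siegelH2}

/-- The product `ℍ × ℍ` as an open subset of `ℂ²`. -/
def halfPlaneProd : Set (ℂ × ℂ) := {z | 0 < z.1.im ∧ 0 < z.2.im}

/-! Functions on `siegelH2` are represented by functions on all `2 × 2` matrices whose values
outside `siegelH2` are irrelevant. -/

/-- `F` is `C^∞` (in the real sense) on Siegel's upper half space: all its coefficients are. -/
def IsSmooth {l : ℕ} (F : Matrix (Fin 2) (Fin 2) ℂ → HomPoly l) : Prop :=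
  ∀ n : Fin 2 →₀ ℕ,
    ContDiffOn ℝ ∞ (fun x => coeff n (F (symMat x) : MvPolynomial (Fin 2) ℂ)) siegelCoord

/-- `F` is holomorphic on Siegel's upper half space: all its coefficients are. -/
def IsHolomorphic {l : ℕ} (F : Matrix (Fin 2) (Fin 2) ℂ → HomPoly l) : Prop :=
  ∀ n : Fin 2 →₀ ℕ,
    DifferentiableOn ℂ (fun x => coeff n (F (symMat x) : MvPolynomial (Fin 2) ℂ)) siegelCoord

/-! ### The slash operators -/

section slash

variable (M : symplecticGroup (Fin 2) ℝ) (Z : Matrix (Fin 2) (Fin 2) ℂ)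

/-- `A Z + B` for `M = (A, B; C, D)`. -/
def numM : Matrix (Fin 2) (Fin 2) ℂ :=
  M.1.toBlocks₁₁.map (algebraMap ℝ ℂ) * Z + M.1.toBlocks₁₂.map (algebraMap ℝ ℂ)

/-- `C Z + D` for `M = (A, B; C, D)`. -/
def denomM : Matrix (Fin 2) (Fin 2) ℂ :=
  M.1.toBlocks₂₁.map (algebraMap ℝ ℂ) * Z + M.1.toBlocks₂₂.map (algebraMap ℝ ℂ)

/-- `M⟨Z⟩ = (A Z + B) (C Z + D)⁻¹`. -/
def actM : Matrix (Fin 2) (Fin 2) ℂ := numM M Z * (denomM M Z)⁻¹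

end slash

/-- `(F |_{k,l} M)(Z) = det(C Z + D)⁻ᵏ σ_l(C Z + D)⁻¹ F(M⟨Z⟩)`. -/
def slashM (k l : ℕ) (F : Matrix (Fin 2) (Fin 2) ℂ → HomPoly l)
    (M : symplecticGroup (Fin 2) ℝ) : Matrix (Fin 2) (Fin 2) ℂ → HomPoly l :=
  fun Z => ((denomM M Z).det ^ k)⁻¹ • symPow l (denomM M Z)⁻¹ (F (actM M Z))

/-- The standard embedding of `SL₂ × SL₂` into `Sp₂`. -/
def embed (M N : SL(2, ℝ)) : symplecticGroup (Fin 2) ℝ :=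
  ⟨fromBlocks (diagonal ![M 0 0, N 0 0]) (diagonal ![M 0 1, N 0 1])
      (diagonal ![M 1 0, N 1 0]) (diagonal ![M 1 1, N 1 1]), by
    have hM := M.det_coe
    have hN := N.det_coe
    rw [Matrix.det_fin_two] at hM hN
    rw [SymplecticGroup.mem_iff, J, fromBlocks_transpose, fromBlocks_multiply,
      fromBlocks_multiply, fromBlocks_inj]
    refine ⟨?_, ?_, ?_, ?_⟩ <;> ext i j <;> fin_cases i <;> fin_cases j <;>
      simp <;> linarith⟩

/-- `M↑`: the embedding on the first factor. -/
def up (M : SL(2, ℝ)) : symplecticGroup (Fin 2) ℝ := embed M 1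

/-- `M↓`: the embedding on the second factor. -/
def down (M : SL(2, ℝ)) : symplecticGroup (Fin 2) ℝ := embed 1 M

/-- `f |_w^{z₁} M`, the slash operator in the first variable. -/
def slashFst (w : ℕ) (f : ℍ × ℍ → ℂ) (M : SL(2, ℝ)) : ℍ × ℍ → ℂ :=
  fun z => ((fun t : ℍ => f (t, z.2)) ∣[(w : ℤ)] (M : GL (Fin 2) ℝ)) z.1

/-- `f |_w^{z₂} M`, the slash operator in the second variable. -/
def slashSnd (w : ℕ) (f : ℍ × ℍ → ℂ) (M : SL(2, ℝ)) : ℍ × ℍ → ℂ :=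
  fun z => ((fun t : ℍ => f (z.1, t)) ∣[(w : ℤ)] (M : GL (Fin 2) ℝ)) z.2

/-- Restriction of a function on `ℂ²` to `ℍ × ℍ`. -/
def resHH (f : ℂ × ℂ → ℂ) : ℍ × ℍ → ℂ := fun z => f (z.1, z.2)

/-! ### The differential operators -/

/-- The Wirtinger derivative `∂/∂z_j = (∂/∂x_j - i ∂/∂y_j) / 2` on functions on `ℂ³` with
coordinates `(z₁, z₁₂, z₂)`; for holomorphic functions it is the complex derivative. -/
def dz (j : Fin 3) (G : (Fin 3 → ℂ) → ℂ) : (Fin 3 → ℂ) → ℂ :=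
  fun x => (fderiv ℝ G x (Pi.single j 1) - Complex.I * fderiv ℝ G x (Pi.single j Complex.I)) / 2

/-- `∂₁^{m 0} ∂₁₂^{m 1} ∂₂^{m 2}`. -/
def dzIter (m : Fin 3 →₀ ℕ) (G : (Fin 3 → ℂ) → ℂ) : (Fin 3 → ℂ) → ℂ :=
  (dz 0)^[m 0] ((dz 1)^[m 1] ((dz 2)^[m 2] G))

/-- `P(X₁² ∂₁, X₁ X₂ ∂₁₂, X₂² ∂₂) F` at the point with coordinates `x = (z₁, z₁₂, z₂)`;
the derivatives act on the coefficients of `F`. -/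
def applyOp {l : ℕ} (P : MvPolynomial (Fin 3) ℂ) (F : Matrix (Fin 2) (Fin 2) ℂ → HomPoly l)
    (x : Fin 3 → ℂ) : MvPolynomial (Fin 2) ℂ :=
  ∑ m ∈ P.support, C (P.coeff m) * (X 0 ^ 2) ^ m 0 * (X 0 * X 1) ^ m 1 * (X 1 ^ 2) ^ m 2 *
    ∑ ij ∈ Finset.HasAntidiagonal.antidiagonal l,
      C (dzIter m (fun y => coeff (bideg ij.1 ij.2)
        (F (symMat y) : MvPolynomial (Fin 2) ℂ)) x) * (X 0 ^ ij.1 * X 1 ^ ij.2)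

/-- The coefficient of `X₁^{a+r} X₂^{b+r}` in `P(X₁² ∂₁, X₁ X₂ ∂₁₂, X₂² ∂₂) F`, evaluated at
`z₁₂ = 0`, as a function of `(z₁, z₂)`. -/
def diagOp (r a b : ℕ) {l : ℕ} (P : MvPolynomial (Fin 3) ℂ)
    (F : Matrix (Fin 2) (Fin 2) ℂ → HomPoly l) : ℂ × ℂ → ℂ :=
  fun z => coeff (bideg (a + r) (b + r)) (applyOp P F ![z.1, 0, z.2])

end SiegelDiff

end

/-! Write `f i` for the coefficient of `X₁^i X₂^(l-i)` in `F`, and look for an operator with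
coefficients `c p n q` on `∂₁^p ∂₁₂^n ∂₂^q`, supported on `p + n + q = r`. Matching powers of `X₁`
shows that this monomial acts on `f (a + q - p)` (`diagOp_triPoly`, `opSum`).

Translations in `z₁` commute with every such operator, and `SL(2, ℝ)` is generated by the two
unipotent subgroups. In the first variable, only the lower unipotent matrices therefore restrict
`c`. Differentiating `F |_{k,l} n_s↑` at `s = 0` gives minus the operator `lieOp`. Apply `∂₁^p ∂₁₂^n
∂₂^q` to it and set `z₁₂ = 0` (`dzMon_lieOp`). The main terms are exactly those of the infinitesimal
slash action of weight `k + a + r`, including the `∂/∂\bar z₁` term, which is present because `F` is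
only smooth. The remainder consists of three families of derivatives of order `r - 1`. Collecting
equal derivatives, it vanishes as soon as `c` satisfies the three-term recursion `IsLoweringKernel`
(`sumExp_lowering`, `opSum_lieOp`).

The second variable is reduced to the first by conjugating with the matrix that swaps the variables
(`down_eq`). It exchanges `a` with `b` and `p` with `q`, so `c q n p` must satisfy the same
recursion with `a`, `b` exchanged. The leading factors of the two recursions are positive for `k ≥
2` (`weight_ne_zero`). Hence `c` can be built from `c 0 r 0 = 1`: the second recursion gives the
face `p = 0`, the first gives the rest. The second recursion then also holds for `p > 0`, by
induction on `p` (`isLoweringKernel_opCoef_symm`). This is the algebraic heart of the proof.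

The infinitesimal statement integrates: pulling the operator applied to `F | n_s↑` back by `n_{-s}`
gives a function of `s` whose derivative vanishes everywhere (`equivariantUp_lowerUni`). The
operator is nonzero because it sends `z₁₂^r X₁^a X₂^b` to the constant `r!`. Preservation of
holomorphy rests on the holomorphy of directional derivatives, proved with Cauchy's formula
(`differentiableOn_fderiv_apply`). -/

namespace SiegelDiff

/-! ### First order differential operators with complex coefficients -/

section wirt

variable {E : Type*} [NormedAddCommGroup E] [NormedSpace ℝ E]

/-- The operator `(∂_u + c ∂_v) / 2`. -/
noncomputable def wirt (u v : E) (c : ℂ) (f : E → ℂ) : E → ℂ :=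
  fun x => (fderiv ℝ f x u + c * fderiv ℝ f x v) / 2

variable {U : Set E} {u v u' v' : E} {c c' : ℂ} {f g : E → ℂ}

lemma wirt_congr (hU : IsOpen U) (h : Set.EqOn f g U) :
    Set.EqOn (wirt u v c f) (wirt u v c g) U := by
  intro x hx
  have : f =ᶠ[nhds x] g := Filter.eventuallyEq_of_mem (hU.mem_nhds hx) h
  simp only [wirt, this.fderiv_eq]

lemma contDiffOn_fderiv_apply (hU : IsOpen U) (hf : ContDiffOn ℝ ∞ f U) (u : E) :
    ContDiffOn ℝ ∞ (fun x => fderiv ℝ f x u) U :=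
  (hf.fderiv_of_isOpen hU (m := ∞) (by simp)).clm_apply contDiffOn_const

lemma contDiffOn_wirt (hU : IsOpen U) (hf : ContDiffOn ℝ ∞ f U) :
    ContDiffOn ℝ ∞ (wirt u v c f) U :=
  ((contDiffOn_fderiv_apply hU hf u).add
    (contDiffOn_const.mul (contDiffOn_fderiv_apply hU hf v))).div_const 2

lemma differentiableAt_of_contDiffOn (hU : IsOpen U) (hf : ContDiffOn ℝ ∞ f U) {x : E}
    (hx : x ∈ U) : DifferentiableAt ℝ f x :=
  (hf.contDiffAt (hU.mem_nhds hx)).differentiableAt (by simp)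

lemma fderiv_fderiv_apply_comm (hU : IsOpen U) (hf : ContDiffOn ℝ ∞ f U) {x : E}
    (hx : x ∈ U) (u v : E) :
    fderiv ℝ (fun y => fderiv ℝ f y u) x v = fderiv ℝ (fun y => fderiv ℝ f y v) x u := by
  have hs := (hf.contDiffAt (hU.mem_nhds hx)).isSymmSndFDerivAt
    (by
      rw [minSmoothness_of_isRCLikeNormedField]
      exact WithTop.coe_le_coe.2 (le_top : (2 : ℕ∞) ≤ ⊤))
  have hd : DifferentiableAt ℝ (fderiv ℝ f) x :=
    ((hf.fderiv_of_isOpen hU (m := ∞) (by simp)).contDiffAt (hU.mem_nhds hx)).differentiableAt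
      (by simp)
  rw [fderiv_clm_apply hd (differentiableAt_const _),
    fderiv_clm_apply hd (differentiableAt_const _)]
  simpa using hs v u

lemma wirt_apply_fderiv (hU : IsOpen U) (hf : ContDiffOn ℝ ∞ f U) {x : E} (hx : x ∈ U) (w : E) :
    fderiv ℝ (wirt u v c f) x w =
      (fderiv ℝ (fun y => fderiv ℝ f y u) x w + c * fderiv ℝ (fun y => fderiv ℝ f y v) x w) / 2 := by
  have h1 := differentiableAt_of_contDiffOn hU (contDiffOn_fderiv_apply hU hf u) hx
  have h2 := differentiableAt_of_contDiffOn hU (contDiffOn_fderiv_apply hU hf v) hx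
  have h : HasFDerivAt (wirt u v c f) _ x :=
    (h1.hasFDerivAt.add (h2.hasFDerivAt.const_mul c)).mul_const (2 : ℂ)⁻¹
  rw [h.fderiv]
  simp [div_eq_inv_mul]
  ring

/-- Symmetry of the second real derivative. Working with arbitrary directions and an arbitrary
constant `c` covers `∂/∂z_j`, `∂/∂\bar z_j` and the derivative in an auxiliary real parameter at the
same time. -/
lemma wirt_comm (hU : IsOpen U) (hf : ContDiffOn ℝ ∞ f U) :
    Set.EqOn (wirt u v c (wirt u' v' c' f)) (wirt u' v' c' (wirt u v c f)) U := by
  intro x hx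
  rw [wirt, wirt]
  simp only [wirt_apply_fderiv hU hf hx]
  rw [fderiv_fderiv_apply_comm hU hf hx u u', fderiv_fderiv_apply_comm hU hf hx u v',
    fderiv_fderiv_apply_comm hU hf hx v u', fderiv_fderiv_apply_comm hU hf hx v v']
  ring

lemma wirt_add (hU : IsOpen U) (hf : ContDiffOn ℝ ∞ f U) (hg : ContDiffOn ℝ ∞ g U) :
    Set.EqOn (wirt u v c (fun x => f x + g x)) (fun x => wirt u v c f x + wirt u v c g x) U := by
  intro x hx
  have h := ((differentiableAt_of_contDiffOn hU hf hx).hasFDerivAt.add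
    (differentiableAt_of_contDiffOn hU hg hx).hasFDerivAt).fderiv
  have e : (fun x => f x + g x) = f + g := rfl
  simp only [wirt, e, h, _root_.add_apply]
  ring

lemma wirt_mul (hU : IsOpen U) (hf : ContDiffOn ℝ ∞ f U) (hg : ContDiffOn ℝ ∞ g U) :
    Set.EqOn (wirt u v c (fun x => f x * g x))
      (fun x => wirt u v c f x * g x + f x * wirt u v c g x) U := by
  intro x hx
  have h := ((differentiableAt_of_contDiffOn hU hf hx).hasFDerivAt.mul
    (differentiableAt_of_contDiffOn hU hg hx).hasFDerivAt).fderiv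
  have e : (fun x => f x * g x) = f * g := rfl
  simp only [wirt, e, h, _root_.add_apply, _root_.smul_apply, smul_eq_mul]
  ring

lemma wirt_const_mul (hU : IsOpen U) (a : ℂ) (hf : ContDiffOn ℝ ∞ f U) :
    Set.EqOn (wirt u v c (fun x => a * f x)) (fun x => a * wirt u v c f x) U := by
  intro x hx
  rw [wirt_mul hU contDiffOn_const hf hx]
  simp [wirt]

lemma wirt_iterate_congr (hU : IsOpen U) (h : Set.EqOn f g U) (n : ℕ) :
    Set.EqOn ((wirt u v c)^[n] f) ((wirt u v c)^[n] g) U := by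
  induction n with
  | zero => exact h
  | succ n ih =>
    rw [Function.iterate_succ_apply', Function.iterate_succ_apply']
    exact wirt_congr hU ih

lemma contDiffOn_wirt_iterate (hU : IsOpen U) (hf : ContDiffOn ℝ ∞ f U) (n : ℕ) :
    ContDiffOn ℝ ∞ ((wirt u v c)^[n] f) U := by
  induction n with
  | zero => exact hf
  | succ n ih =>
    rw [Function.iterate_succ_apply']
    exact contDiffOn_wirt hU ih

lemma wirt_iterate_comm (hU : IsOpen U) (hf : ContDiffOn ℝ ∞ f U) (n : ℕ) :
    Set.EqOn ((wirt u v c)^[n] (wirt u' v' c' f)) (wirt u' v' c' ((wirt u v c)^[n] f)) U := by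
  induction n with
  | zero => exact fun x _ => rfl
  | succ n ih =>
    rw [Function.iterate_succ_apply', Function.iterate_succ_apply']
    exact (wirt_congr hU ih).trans (wirt_comm hU (contDiffOn_wirt_iterate hU hf n))

lemma wirt_iterate_comm_iterate (hU : IsOpen U) (hf : ContDiffOn ℝ ∞ f U) (n m : ℕ) :
    Set.EqOn ((wirt u v c)^[n] ((wirt u' v' c')^[m] f))
      ((wirt u' v' c')^[m] ((wirt u v c)^[n] f)) U := by
  induction m with
  | zero => exact fun x _ => rfl
  | succ m ih =>
    rw [Function.iterate_succ_apply', Function.iterate_succ_apply']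
    exact (wirt_iterate_comm hU (contDiffOn_wirt_iterate hU hf m) n).trans (wirt_congr hU ih)

lemma wirt_iterate_add (hU : IsOpen U) (hf : ContDiffOn ℝ ∞ f U) (hg : ContDiffOn ℝ ∞ g U)
    (n : ℕ) :
    Set.EqOn ((wirt u v c)^[n] (fun x => f x + g x))
      (fun x => (wirt u v c)^[n] f x + (wirt u v c)^[n] g x) U := by
  induction n with
  | zero => exact fun x _ => rfl
  | succ n ih =>
    simp only [Function.iterate_succ_apply']
    exact (wirt_congr hU ih).trans
      (wirt_add hU (contDiffOn_wirt_iterate hU hf n) (contDiffOn_wirt_iterate hU hg n))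

/-- A function that is constant for the operator passes through it. -/
lemma wirt_iterate_mul_of_eq_zero (hU : IsOpen U) (hf : ContDiffOn ℝ ∞ f U)
    (hg : ContDiffOn ℝ ∞ g U) (h0 : ∀ x ∈ U, wirt u v c f x = 0) (n : ℕ) :
    Set.EqOn ((wirt u v c)^[n] (fun x => f x * g x)) (fun x => f x * (wirt u v c)^[n] g x) U := by
  induction n with
  | zero => exact fun x _ => rfl
  | succ n ih =>
    simp only [Function.iterate_succ_apply']
    refine (wirt_congr hU ih).trans fun x hx => ?_
    rw [wirt_mul hU hf (contDiffOn_wirt_iterate hU hg n) hx]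
    simp [h0 x hx]

/-- The Leibniz rule for a factor on which the operator takes the value one. -/
lemma wirt_iterate_mul_of_eq_one (hU : IsOpen U) (hf : ContDiffOn ℝ ∞ f U)
    (hg : ContDiffOn ℝ ∞ g U) (h1 : ∀ x ∈ U, wirt u v c f x = 1) (n : ℕ) :
    Set.EqOn ((wirt u v c)^[n] (fun x => f x * g x))
      (fun x => f x * (wirt u v c)^[n] g x + n * (wirt u v c)^[n - 1] g x) U := by
  induction n with
  | zero => exact fun x _ => by simp
  | succ n ih =>
    have hs := fun m => contDiffOn_wirt_iterate (u := u) (v := v) (c := c) hU hg m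
    simp only [Function.iterate_succ_apply']
    refine (wirt_congr hU ih).trans fun x hx => ?_
    rw [wirt_add hU (hf.mul (hs n)) (contDiffOn_const.mul (hs (n - 1))) hx]
    dsimp only
    rw [wirt_mul hU hf (hs n) hx, wirt_const_mul hU _ (hs (n - 1)) hx]
    dsimp only
    rw [h1 x hx]
    -- For `n = 0` the truncated exponent `n - 1` is harmless, since it comes with the factor `n`.
    cases n with
    | zero => simp [add_comm]
    | succ n =>
      simp only [Nat.add_sub_cancel, Function.iterate_succ_apply', Nat.cast_add, Nat.cast_one]
      ring

end wirt

end SiegelDiff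

namespace SiegelDiff

/-! ### Holomorphic functions of several variables -/

open Complex Metric in
/-- The directional derivatives of a holomorphic function of several variables are holomorphic. -/
lemma differentiableOn_fderiv_apply {E : Type*} [NormedAddCommGroup E] [NormedSpace ℂ E]
    [FiniteDimensional ℂ E] {U : Set E} (hU : IsOpen U) {f : E → ℂ}
    (hf : DifferentiableOn ℂ f U) (v : E) :
    DifferentiableOn ℂ (fun x => fderiv ℂ f x v) U := by
  intro x₀ hx₀
  apply DifferentiableAt.differentiableWithinAt
  have hd : ∀ x ∈ U, DifferentiableAt ℂ f x := fun x hx => hf.differentiableAt (hU.mem_nhds hx)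
  obtain ⟨R, hR, hRU, hRM⟩ : ∃ R > 0, ball x₀ R ⊆ U ∧ ∀ x ∈ ball x₀ R, dist (f x) (f x₀) < 1 := by
    have h := (hU.eventually_mem hx₀).and ((hd x₀ hx₀).continuousAt.eventually (ball_mem_nhds _ one_pos))
    obtain ⟨R, hR, h⟩ := Metric.eventually_nhds_iff_ball.1 h
    exact ⟨R, hR, fun x hx => (h x hx).1, fun x hx => (h x hx).2⟩
  -- Values of `f` on the ball of radius `R` differ by less than 2, so Cauchy's estimate bounds the
  -- derivative uniformly. This bound later dominates the differentiated integrand.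
  have hbd : ∀ x ∈ ball x₀ (R / 2), ‖fderiv ℂ f x‖ ≤ 2 / (R / 2) := by
    intro x hx
    have hsub : ball x (R / 2) ⊆ ball x₀ R := ball_subset_ball' (by
      have := mem_ball.1 hx
      linarith)
    refine norm_fderiv_le_div_of_mapsTo_ball (hf.mono (hsub.trans hRU)) (fun y hy => ?_)
      (by positivity)
    have h1 := hRM y (hsub hy)
    have h2 := hRM x (hsub (mem_ball_self (by positivity)))
    rw [mem_closedBall]
    have := dist_triangle_right (f y) (f x) (f x₀)
    linarith
  -- The circle `x + ε e^{iθ} v` must stay in the ball of radius `R / 2` for all `x` within `R / 4`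
  -- of `x₀`.
  obtain ⟨ε, hε, hεv⟩ : ∃ ε > 0, ε * ‖v‖ < R / 4 :=
    ⟨R / 4 / (‖v‖ + 1), by positivity, by
      rw [div_mul_eq_mul_div, div_lt_iff₀ (by positivity)]
      nlinarith [norm_nonneg v]⟩
  have hmem : ∀ x ∈ ball x₀ (R / 4), ∀ z ∈ closedBall (0 : ℂ) ε, x + z • v ∈ ball x₀ (R / 2) := by
    intro x hx z hz
    rw [mem_ball, dist_eq_norm] at *
    rw [mem_closedBall, dist_zero_right] at hz
    calc ‖x + z • v - x₀‖ = ‖(x - x₀) + z • v‖ := by congr 1; abel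
      _ ≤ ‖x - x₀‖ + ‖z‖ * ‖v‖ := (norm_add_le _ _).trans_eq (by rw [norm_smul])
      _ < R / 2 := by nlinarith [mul_le_mul_of_nonneg_right hz (norm_nonneg v)]
  have hRU' : ball x₀ (R / 2) ⊆ U := (ball_subset_ball (by linarith)).trans hRU
  let w : ℝ → ℂ := fun θ => deriv (circleMap 0 ε) θ * ((circleMap 0 ε θ - 0) ^ 2)⁻¹
  have hw : Continuous w := by
    refine Continuous.mul ?_ (Continuous.inv₀ (by fun_prop) fun θ => ?_)
    · have h : deriv (circleMap 0 ε) = fun θ => circleMap 0 ε θ * I := by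
        ext θ
        simp
      rw [h]
      fun_prop
    · simp [hε.ne']
  -- Cauchy's formula on the complex line through `x` in direction `v` expresses the derivative
  -- through values of `f` only. Differentiability in `x` then follows by differentiating under the
  -- integral.
  have key : ∀ x ∈ ball x₀ (R / 4), fderiv ℂ f x v =
      (2 * Real.pi * I : ℂ)⁻¹ • ∫ θ in (0 : ℝ)..2 * Real.pi, w θ • f (x + circleMap 0 ε θ • v) := by
    intro x hx
    have hV : IsOpen {z : ℂ | x + z • v ∈ U} := hU.preimage (by fun_prop)
    have hg : DifferentiableOn ℂ (fun z : ℂ => f (x + z • v)) {z : ℂ | x + z • v ∈ U} :=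
      hf.comp (by fun_prop) fun z hz => hz
    have h := two_pi_I_inv_smul_circleIntegral_sub_sq_inv_smul_of_differentiable hV
      (fun z hz => hRU' (hmem x hx z hz)) hg (mem_ball_self hε)
    have hder : HasDerivAt (fun z : ℂ => f (x + z • v)) (fderiv ℂ f x v) 0 := by
      have h1 : HasDerivAt (fun z : ℂ => x + z • v) v 0 := by
        simpa using ((hasDerivAt_id (0 : ℂ)).smul_const v).const_add x
      have h2 : HasFDerivAt f (fderiv ℂ f x) (x + (0 : ℂ) • v) := by
        simpa using (hd x (by simpa using hRU' (hmem x hx 0 (by simp [hε.le])))).hasFDerivAt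
      exact h2.comp_hasDerivAt 0 h1
    rw [hder.deriv] at h
    rw [← h, circleIntegral]
    simp only [w, smul_eq_mul, mul_assoc]
  have hloc : (fun x => fderiv ℂ f x v) =ᶠ[nhds x₀] fun x =>
      (2 * Real.pi * I : ℂ)⁻¹ • ∫ θ in (0 : ℝ)..2 * Real.pi, w θ • f (x + circleMap 0 ε θ • v) :=
    Filter.eventuallyEq_of_mem (ball_mem_nhds x₀ (by positivity)) key
  refine DifferentiableAt.congr_of_eventuallyEq ?_ hloc
  refine DifferentiableAt.fun_const_smul ?_ _
  have hcirc : ∀ θ, circleMap 0 ε θ ∈ closedBall (0 : ℂ) ε := fun θ =>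
    circleMap_mem_closedBall 0 hε.le θ
  have hcont : ∀ x ∈ ball x₀ (R / 4), Continuous fun θ => w θ • f (x + circleMap 0 ε θ • v) := by
    intro x hx
    refine hw.smul (continuous_iff_continuousAt.2 fun θ => ?_)
    exact (hd _ (hRU' (hmem x hx _ (hcirc θ)))).continuousAt.comp
      (f := fun θ => x + circleMap 0 ε θ • v) (by fun_prop)
  have hx₀' : x₀ ∈ ball x₀ (R / 4) := mem_ball_self (by positivity)
  borelize E
  refine (intervalIntegral.hasFDerivAt_integral_of_dominated_of_fderiv_le
    (F' := fun x θ => w θ • fderiv ℂ f (x + circleMap 0 ε θ • v))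
    (bound := fun θ => ‖w θ‖ * (2 / (R / 2)))
    (ball_mem_nhds x₀ (by positivity : 0 < R / 4)) ?_ ?_ ?_ ?_ ?_ ?_).differentiableAt
  · exact Filter.eventually_of_mem (ball_mem_nhds x₀ (by positivity : 0 < R / 4)) fun x hx =>
      (hcont x hx).aestronglyMeasurable
  · exact (hcont x₀ hx₀').intervalIntegrable _ _
  · have : FiniteDimensional ℂ (E →L[ℂ] ℂ) := inferInstance
    have : ProperSpace E := FiniteDimensional.proper ℂ E
    have : SecondCountableTopology (E →L[ℂ] ℂ) :=
      have := FiniteDimensional.proper ℂ (E →L[ℂ] ℂ)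
      inferInstance
    refine (hw.measurable.smul ((measurable_fderiv ℂ f).comp ?_)).aestronglyMeasurable
    exact Continuous.measurable (by fun_prop)
  · refine Filter.Eventually.of_forall fun θ _ x hx => ?_
    rw [norm_smul]
    exact mul_le_mul_of_nonneg_left (hbd _ (hmem x hx _ (hcirc θ))) (norm_nonneg _)
  · exact (hw.norm.mul continuous_const).intervalIntegrable _ _
  · refine Filter.Eventually.of_forall fun θ _ x hx => HasFDerivAt.fun_const_smul ?_ _
    have h2 := (hd _ (hRU' (hmem x hx _ (hcirc θ)))).hasFDerivAt
    exact HasFDerivAt.comp (f := fun x => x + circleMap 0 ε θ • v) x h2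
      ((hasFDerivAt_id x).add_const _)

end SiegelDiff

namespace SiegelDiff

/-! ### The coefficients of the operator -/

section coefficients

variable (k r a b : ℕ)

/-- The coefficients of the monomials `∂₁₂ ^ n * ∂₂ ^ q`. -/
noncomputable def baseCoef : ℕ → ℕ → ℂ
  | n, 0 => if n = r then 1 else 0
  | n, q + 1 => -((n + 1) * (a + q + 1) * baseCoef (n + 1) q) / ((q + 1) * (k + b + r - 2 - q))

/-- The coefficients of the monomials `∂₁ ^ p * ∂₁₂ ^ n * ∂₂ ^ q`. -/
noncomputable def opCoef : ℕ → ℕ → ℕ → ℂ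
  | 0, n, q => baseCoef k r a b n q
  | p + 1, n, 0 =>
    -((n + 1) * (b + p + 1) * opCoef p (n + 1) 0) / ((p + 1) * (k + a + r - 2 - p))
  | p + 1, n, q + 1 =>
    -((n + 1) * (b + p - (q + 1) + 1) * opCoef p (n + 1) (q + 1)
      + (n + 2) * (n + 1) * opCoef p (n + 2) q) / ((p + 1) * (k + a + r - 2 - p))

variable {k r a b}

lemma baseCoef_eq_zero {n q : ℕ} (h : n + q ≠ r) : baseCoef k r a b n q = 0 := by
  induction q generalizing n with
  | zero => simp_all [baseCoef]
  | succ q ih => rw [baseCoef, ih (by omega)]; simp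

lemma opCoef_eq_zero {p n q : ℕ} (h : p + n + q ≠ r) : opCoef k r a b p n q = 0 := by
  induction p generalizing n q with
  | zero => exact baseCoef_eq_zero (by omega)
  | succ p ih =>
    cases q with
    | zero => rw [opCoef, ih (by omega)]; simp
    | succ q => rw [opCoef, ih (by omega), ih (by omega)]; simp

lemma opCoef_zero_zero : opCoef k r a b 0 r 0 = 1 := by simp [opCoef, baseCoef]

/-- The factor equals `(k - 2) + c + (r - p)`, a natural number that is positive for `p < r`. This
is where `k ≥ 2` enters. -/
lemma weight_ne_zero {c p : ℕ} (hk : 2 ≤ k) (hp : p < r) : ((k : ℂ) + c + r - 2 - p) ≠ 0 := by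
  have h : ((k : ℂ) + c + r - 2 - p) = ((k - 2 + c + (r - p) : ℕ) : ℂ) := by
    push_cast [Nat.cast_sub hk, Nat.cast_sub hp.le]
    ring
  rw [h, Nat.cast_ne_zero]
  omega

/-- The contribution of the exponents `(p, n + 2, q - 1)`. -/
noncomputable def prevCoef (c : ℕ → ℕ → ℂ) (n : ℕ) : ℕ → ℂ
  | 0 => 0
  | q + 1 => c (n + 2) q

/-- The recursion in the first variable. -/
def IsLoweringKernel (k r a b : ℕ) (c : ℕ → ℕ → ℕ → ℂ) : Prop :=
  ∀ p n q : ℕ, (p + 1) * ((k : ℂ) + a + r - 2 - p) * c (p + 1) n q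
    + (n + 1) * (b + p - q + 1) * c p (n + 1) q + (n + 2) * (n + 1) * prevCoef (c p) n q = 0

/-- For `p < r` this is the definition of `opCoef` with denominators cleared; for `p ≥ r` every
coefficient involved lies off `p + n + q = r`. -/
lemma isLoweringKernel_opCoef (hk : 2 ≤ k) : IsLoweringKernel k r a b (opCoef k r a b) := by
  intro p n q
  by_cases h : p < r
  · have h1 := weight_ne_zero (c := a) hk h
    have h2 : (p + 1 : ℂ) ≠ 0 := by exact_mod_cast p.succ_ne_zero
    cases q with
    | zero =>
      rw [opCoef, prevCoef]
      field_simp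
      push_cast
      ring
    | succ q =>
      rw [opCoef, prevCoef]
      field_simp
      push_cast
      ring
  · rw [opCoef_eq_zero (by omega), opCoef_eq_zero (by omega)]
    cases q with
    | zero => simp [prevCoef]
    | succ q => rw [prevCoef, opCoef_eq_zero (by omega)]; simp

/-- Compatibility of the two recursions. On the face `p = 0` the claim is the definition of
`baseCoef`. It propagates in `p` because the first recursion carries the relation at `p` to the
relation at `p + 1`. -/
lemma isLoweringKernel_opCoef_symm (hk : 2 ≤ k) :
    IsLoweringKernel k r b a (fun p n q => opCoef k r a b q n p) := by
  have hA := isLoweringKernel_opCoef (r := r) (a := a) (b := b) hk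
  suffices h : ∀ p q n : ℕ, (q + 1) * ((k : ℂ) + b + r - 2 - q) * opCoef k r a b p n (q + 1)
      + (n + 1) * (a + q - p + 1) * opCoef k r a b p (n + 1) q
      + (n + 2) * (n + 1) * prevCoef (fun n p => opCoef k r a b p n q) n p = 0 from
    fun q n p => h p q n
  intro p
  induction p with
  | zero =>
    intro q n
    by_cases h : q < r
    · have h1 := weight_ne_zero (c := b) hk h
      have h2 : (q + 1 : ℂ) ≠ 0 := by exact_mod_cast q.succ_ne_zero
      simp only [opCoef, prevCoef, baseCoef]
      field_simp
      push_cast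
      ring
    · rw [opCoef_eq_zero (by omega), opCoef_eq_zero (by omega)]
      simp [prevCoef]
  | succ p ih =>
    intro q n
    by_cases h : p < r
    · have h1 := weight_ne_zero (c := a) hk h
      have h2 : (p + 1 : ℂ) ≠ 0 := by exact_mod_cast p.succ_ne_zero
      -- Multiply by the leading factor of the first recursion. Then `A1` and `A2` remove the
      -- coefficients whose first index has just been raised, and what remains is a combination of
      -- `A3` and the induction hypotheses `i1`, `i2`. `A3` needs a positive previous first index
      -- and `i2` a positive third index, hence four cases.
      refine (mul_eq_zero.1 ?_).resolve_left (mul_ne_zero h2 h1)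
      have i1 := ih q (n + 1)
      have A1 := hA p n (q + 1)
      have A2 := hA p (n + 1) q
      cases q with
      | zero =>
        cases p with
        | zero =>
          simp only [prevCoef] at *
          push_cast at *
          linear_combination (k + b + r - 2 : ℂ) * A1 + (n + 1) * (a : ℂ) * A2
            - (n + 1) * (b : ℂ) * i1
        | succ p =>
          have A3 := hA p (n + 2) 0
          simp only [prevCoef] at *
          push_cast at *
          linear_combination (k + b + r - 2 : ℂ) * A1 + (n + 1) * (a - (p + 1) : ℂ) * A2
            + (n + 2) * (n + 1) * A3 - (n + 1) * (b + (p + 1) : ℂ) * i1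
      | succ q =>
        have i2 := ih q (n + 2)
        cases p with
        | zero =>
          simp only [prevCoef] at *
          push_cast at *
          linear_combination (q + 2) * (k + b + r - 2 - (q + 1) : ℂ) * A1
            + (n + 1) * (a + (q + 1) : ℂ) * A2
            - (n + 1) * (b - (q + 1) : ℂ) * i1 - (n + 2) * (n + 1) * i2
        | succ p =>
          have A3 := hA p (n + 2) (q + 1)
          simp only [prevCoef] at *
          push_cast at *
          linear_combination (q + 2) * (k + b + r - 2 - (q + 1) : ℂ) * A1
            + (n + 1) * (a + (q + 1) - (p + 1) : ℂ) * A2 + (n + 2) * (n + 1) * A3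
            - (n + 1) * (b + (p + 1) - (q + 1) : ℂ) * i1 - (n + 2) * (n + 1) * i2
    · rw [opCoef_eq_zero (by omega), opCoef_eq_zero (by omega), prevCoef,
        opCoef_eq_zero (by omega)]
      simp

end coefficients

end SiegelDiff

namespace SiegelDiff

open ComplexConjugate

/-! ### The Wirtinger derivatives -/

lemma dz_eq_wirt (j : Fin 3) :
    dz j = wirt (Pi.single j 1) (Pi.single j Complex.I) (-Complex.I) := by
  ext G x
  simp [dz, wirt, sub_eq_add_neg]

/-- The Wirtinger derivative `∂/∂\bar z_j`. -/
noncomputable def dzConj (j : Fin 3) (G : (Fin 3 → ℂ) → ℂ) : (Fin 3 → ℂ) → ℂ :=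
  wirt (Pi.single j 1) (Pi.single j Complex.I) Complex.I G

/-- `∂₁^p ∂₁₂^n ∂₂^q`. -/
noncomputable def dzMon (p n q : ℕ) (G : (Fin 3 → ℂ) → ℂ) : (Fin 3 → ℂ) → ℂ :=
  (dz 0)^[p] ((dz 1)^[n] ((dz 2)^[q] G))

lemma contDiff_coord (j : Fin 3) : ContDiff ℝ ∞ (fun x : Fin 3 → ℂ => x j) := by fun_prop

lemma contDiff_conj_coord (j : Fin 3) : ContDiff ℝ ∞ (fun x : Fin 3 → ℂ => conj (x j)) :=
  Complex.conjCLE.contDiff.comp (contDiff_coord j)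

lemma fderiv_coord (i : Fin 3) (x v : Fin 3 → ℂ) :
    fderiv ℝ (fun x : Fin 3 → ℂ => x i) x v = v i := by
  have h : HasFDerivAt (fun x : Fin 3 → ℂ => x i)
      (ContinuousLinearMap.proj i : (Fin 3 → ℂ) →L[ℝ] ℂ) x :=
    (ContinuousLinearMap.proj i : (Fin 3 → ℂ) →L[ℝ] ℂ).hasFDerivAt
  rw [h.fderiv]
  rfl

lemma fderiv_conj_coord (i : Fin 3) (x v : Fin 3 → ℂ) :
    fderiv ℝ (fun x : Fin 3 → ℂ => conj (x i)) x v = conj (v i) := by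
  have h : HasFDerivAt (fun x : Fin 3 → ℂ => conj (x i))
      ((Complex.conjCLE : ℂ →L[ℝ] ℂ).comp
        (ContinuousLinearMap.proj i : (Fin 3 → ℂ) →L[ℝ] ℂ)) x :=
    ((Complex.conjCLE : ℂ →L[ℝ] ℂ).comp
      (ContinuousLinearMap.proj i : (Fin 3 → ℂ) →L[ℝ] ℂ)).hasFDerivAt
  rw [h.fderiv]
  rfl

lemma dz_coord (i j : Fin 3) (x : Fin 3 → ℂ) :
    dz j (fun x => x i) x = if i = j then 1 else 0 := by
  simp only [dz, fderiv_coord, Pi.single_apply]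
  split_ifs <;> norm_num

lemma dz_conj_coord (i j : Fin 3) (x : Fin 3 → ℂ) : dz j (fun x => conj (x i)) x = 0 := by
  simp only [dz, fderiv_conj_coord, Pi.single_apply]
  split_ifs <;> simp

/-- The real derivative in terms of the Wirtinger derivatives. -/
lemma fderiv_eq_sum_dz (G : (Fin 3 → ℂ) → ℂ) (x v : Fin 3 → ℂ) :
    fderiv ℝ G x v = ∑ j, (v j * dz j G x + conj (v j) * dzConj j G x) := by
  have hv : v = ∑ j, ((v j).re • (Pi.single j 1 : Fin 3 → ℂ)
      + (v j).im • (Pi.single j Complex.I : Fin 3 → ℂ)) := by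
    ext i
    simp [Fin.sum_univ_three, Pi.single_apply]
    fin_cases i <;> simp [Complex.re_add_im]
  conv_lhs => rw [hv]
  rw [map_sum]
  refine Finset.sum_congr rfl fun j _ => ?_
  simp only [map_add, map_smul, dz, dzConj, wirt, Complex.real_smul]
  have h1 := Complex.re_add_im (v j)
  have h2 : conj (v j) = (v j).re - (v j).im * Complex.I := by
    conv_lhs => rw [← h1]
    simp only [map_add, map_mul, Complex.conj_ofReal, Complex.conj_I]
    ring
  rw [h2]
  nth_rw 3 [← h1]
  ring_nf
  simp only [Complex.I_sq]
  ring

/-! ### Calculus of the monomials `∂₁^p ∂₁₂^n ∂₂^q`. -/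

section dzMon

variable {U : Set (Fin 3 → ℂ)} {g h : (Fin 3 → ℂ) → ℂ} {p n q : ℕ} {x : Fin 3 → ℂ}

lemma dzMon_congr (hU : IsOpen U) (e : Set.EqOn g h U) :
    Set.EqOn (dzMon p n q g) (dzMon p n q h) U := by
  simp only [dzMon, dz_eq_wirt]
  exact wirt_iterate_congr hU (wirt_iterate_congr hU (wirt_iterate_congr hU e _) _) _

lemma contDiffOn_dzMon (hU : IsOpen U) (hg : ContDiffOn ℝ ∞ g U) :
    ContDiffOn ℝ ∞ (dzMon p n q g) U := by
  simp only [dzMon, dz_eq_wirt]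
  exact contDiffOn_wirt_iterate hU (contDiffOn_wirt_iterate hU (contDiffOn_wirt_iterate hU hg _) _) _

lemma contDiffOn_dz (hU : IsOpen U) (hg : ContDiffOn ℝ ∞ g U) (j : Fin 3) :
    ContDiffOn ℝ ∞ (dz j g) U := by
  rw [dz_eq_wirt]
  exact contDiffOn_wirt hU hg

lemma contDiffOn_dzConj (hU : IsOpen U) (hg : ContDiffOn ℝ ∞ g U) (j : Fin 3) :
    ContDiffOn ℝ ∞ (dzConj j g) U :=
  contDiffOn_wirt hU hg

lemma dzMon_add (hU : IsOpen U) (hg : ContDiffOn ℝ ∞ g U) (hh : ContDiffOn ℝ ∞ h U)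
    (hx : x ∈ U) : dzMon p n q (fun x => g x + h x) x = dzMon p n q g x + dzMon p n q h x := by
  simp only [dzMon, dz_eq_wirt]
  have h2 := fun f (hf : ContDiffOn ℝ ∞ f U) => contDiffOn_wirt_iterate
    (u := Pi.single 2 1) (v := Pi.single 2 Complex.I) (c := -Complex.I) hU hf q
  have h1 := fun f (hf : ContDiffOn ℝ ∞ f U) => contDiffOn_wirt_iterate
    (u := Pi.single 1 1) (v := Pi.single 1 Complex.I) (c := -Complex.I) hU hf n
  exact (((wirt_iterate_congr hU ((wirt_iterate_congr hU (wirt_iterate_add hU hg hh q) n).trans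
    (wirt_iterate_add hU (h2 _ hg) (h2 _ hh) n)) p).trans
      (wirt_iterate_add hU (h1 _ (h2 _ hg)) (h1 _ (h2 _ hh)) p))) hx

/-- Antiholomorphic factors pass through holomorphic derivatives. It is used for constants and for
the conjugate coordinates in the `∂/∂\bar z` part of `lieOp`. -/
lemma dzMon_mul_of_dz_eq_zero (hU : IsOpen U) (hg : ContDiffOn ℝ ∞ g U) (hh : ContDiffOn ℝ ∞ h U)
    (h0 : ∀ j, ∀ x ∈ U, dz j g x = 0) (hx : x ∈ U) :
    dzMon p n q (fun x => g x * h x) x = g x * dzMon p n q h x := by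
  simp only [dzMon, dz_eq_wirt] at h0 ⊢
  have h2 := contDiffOn_wirt_iterate
    (u := Pi.single 2 1) (v := Pi.single 2 Complex.I) (c := -Complex.I) hU hh q
  have h1 := contDiffOn_wirt_iterate
    (u := Pi.single 1 1) (v := Pi.single 1 Complex.I) (c := -Complex.I) hU h2 n
  exact ((wirt_iterate_congr hU ((wirt_iterate_congr hU
    (wirt_iterate_mul_of_eq_zero hU hg hh (h0 2) q) n).trans
    (wirt_iterate_mul_of_eq_zero hU hg h2 (h0 1) n)) p).trans
      (wirt_iterate_mul_of_eq_zero hU hg h1 (h0 0) p)) hx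

lemma dzMon_const_mul (hU : IsOpen U) (a : ℂ) (hg : ContDiffOn ℝ ∞ g U) (hx : x ∈ U) :
    dzMon p n q (fun x => a * g x) x = a * dzMon p n q g x :=
  dzMon_mul_of_dz_eq_zero (g := fun _ => a) hU contDiffOn_const hg (by simp [dz]) hx

lemma dzMon_conj_mul (hU : IsOpen U) (j : Fin 3) (hg : ContDiffOn ℝ ∞ g U) (hx : x ∈ U) :
    dzMon p n q (fun x => conj (x j) * g x) x = conj (x j) * dzMon p n q g x :=
  dzMon_mul_of_dz_eq_zero hU (contDiff_conj_coord j).contDiffOn hg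
    (fun i x _ => dz_conj_coord j i x) hx

lemma dzMon_coord_zero_mul (hU : IsOpen U) (hg : ContDiffOn ℝ ∞ g U) (hx : x ∈ U) :
    dzMon p n q (fun x => x 0 * g x) x = x 0 * dzMon p n q g x + p * dzMon (p - 1) n q g x := by
  have h0 : ∀ j, dz j (fun x => x 0) = fun _ => if 0 = j then 1 else 0 := fun j => by
    ext x
    exact dz_coord 0 j x
  simp only [dzMon, dz_eq_wirt] at h0 ⊢
  have hc := (contDiff_coord 0).contDiffOn (s := U)
  have h2 := contDiffOn_wirt_iterate
    (u := Pi.single 2 1) (v := Pi.single 2 Complex.I) (c := -Complex.I) hU hg q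
  have h1 := contDiffOn_wirt_iterate
    (u := Pi.single 1 1) (v := Pi.single 1 Complex.I) (c := -Complex.I) hU h2 n
  exact ((wirt_iterate_congr hU ((wirt_iterate_congr hU
    (wirt_iterate_mul_of_eq_zero hU hc hg (fun x _ => by simp [h0]) q) n).trans
    (wirt_iterate_mul_of_eq_zero hU hc h2 (fun x _ => by simp [h0]) n)) p).trans
      (wirt_iterate_mul_of_eq_one hU hc h1 (fun x _ => by simp [h0]) p)) hx

lemma dzMon_coord_one_mul (hU : IsOpen U) (hg : ContDiffOn ℝ ∞ g U) (hx : x ∈ U) :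
    dzMon p n q (fun x => x 1 * g x) x = x 1 * dzMon p n q g x + n * dzMon p (n - 1) q g x := by
  have h0 : ∀ j, dz j (fun x => x 1) = fun _ => if 1 = j then 1 else 0 := fun j => by
    ext x
    exact dz_coord 1 j x
  have hc := (contDiff_coord 1).contDiffOn (s := U)
  have hh := fun m => contDiffOn_dzMon (p := 0) (n := m) (q := q) hU hg
  have hs : Set.EqOn ((dz 1)^[n] ((dz 2)^[q] (fun x => x 1 * g x)))
      (fun x => x 1 * dzMon 0 n q g x + n * dzMon 0 (n - 1) q g x) U := by
    simp only [dzMon, dz_eq_wirt] at h0 ⊢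
    have h2 := contDiffOn_wirt_iterate
      (u := Pi.single 2 1) (v := Pi.single 2 Complex.I) (c := -Complex.I) hU hg q
    exact (wirt_iterate_congr hU
      (wirt_iterate_mul_of_eq_zero hU hc hg (fun x _ => by simp [h0]) q) n).trans
      (wirt_iterate_mul_of_eq_one hU hc h2 (fun x _ => by simp [h0]) n)
  have hp := dzMon_congr (p := p) (n := 0) (q := 0) hU hs hx
  have e : dzMon p n q (fun x => x 1 * g x) x
    = dzMon p 0 0 ((dz 1)^[n] ((dz 2)^[q] (fun x => x 1 * g x))) x := rfl
  rw [e, hp, dzMon_add hU (hc.mul (hh n)) (contDiffOn_const.mul (hh _)) hx,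
    dzMon_const_mul hU _ (hh _) hx]
  congr 1
  have hp0 : ∀ G : (Fin 3 → ℂ) → ℂ, dzMon p 0 0 G = (dz 0)^[p] G := fun G => rfl
  rw [hp0]
  simp only [dzMon, dz_eq_wirt] at h0 hh ⊢
  exact wirt_iterate_mul_of_eq_zero hU hc (hh n) (fun x _ => by simp [h0]) p hx

lemma dzMon_wirt (hU : IsOpen U) (hg : ContDiffOn ℝ ∞ g U) {u v : Fin 3 → ℂ} {c : ℂ} :
    Set.EqOn (dzMon p n q (wirt u v c g)) (wirt u v c (dzMon p n q g)) U := by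
  simp only [dzMon, dz_eq_wirt]
  have h2 := contDiffOn_wirt_iterate
    (u := Pi.single 2 1) (v := Pi.single 2 Complex.I) (c := -Complex.I) hU hg q
  have h1 := contDiffOn_wirt_iterate
    (u := Pi.single 1 1) (v := Pi.single 1 Complex.I) (c := -Complex.I) hU h2 n
  exact (wirt_iterate_congr hU ((wirt_iterate_congr hU (wirt_iterate_comm hU hg q) n).trans
    (wirt_iterate_comm hU h2 n)) p).trans (wirt_iterate_comm hU h1 p)

lemma dzMon_dzConj (hU : IsOpen U) (hg : ContDiffOn ℝ ∞ g U) (j : Fin 3) (hx : x ∈ U) :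
    dzMon p n q (dzConj j g) x = dzConj j (dzMon p n q g) x :=
  dzMon_wirt hU hg hx

lemma dzMon_dz (hU : IsOpen U) (hg : ContDiffOn ℝ ∞ g U) (j : Fin 3) (hx : x ∈ U) :
    dzMon p n q (dz j g) x = dz j (dzMon p n q g) x := by
  rw [dz_eq_wirt j]
  exact dzMon_wirt hU hg hx

lemma dzMon_dz_zero (hU : IsOpen U) (hg : ContDiffOn ℝ ∞ g U) (hx : x ∈ U) :
    dzMon p n q (dz 0 g) x = dzMon (p + 1) n q g x := by
  rw [dzMon_dz hU hg 0 hx, dzMon, dzMon, Function.iterate_succ_apply']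

lemma dzMon_dz_one (hU : IsOpen U) (hg : ContDiffOn ℝ ∞ g U) (hx : x ∈ U) :
    dzMon p n q (dz 1 g) x = dzMon p (n + 1) q g x := by
  have h : Set.EqOn (dzMon 0 n q (dz 1 g)) (dzMon 0 (n + 1) q g) U := by
    intro y hy
    rw [dzMon_dz hU hg 1 hy, dzMon, dzMon, Function.iterate_succ_apply']
    rfl
  exact dzMon_congr (p := p) (n := 0) (q := 0) hU h hx

lemma dzMon_dz_two : dzMon p n q (dz 2 g) = dzMon p n (q + 1) g := rfl

lemma dzMon_zero : dzMon p n q (fun _ => 0) = fun _ => 0 := by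
  have h : ∀ j m, (dz j)^[m] (fun _ => 0) = fun _ => 0 := fun j m => by
    induction m with
    | zero => rfl
    | succ m ih => rw [Function.iterate_succ_apply', ih]; ext; simp [dz]
  simp only [dzMon, h]

end dzMon

end SiegelDiff

namespace SiegelDiff

open ComplexConjugate

/-! ### The infinitesimal form of the equivariance -/

/-- Shifting a summation index costs nothing when the terms at both ends vanish. Below, one end
vanishes through a factor `p` or `n` (or by the convention in `prevCoef`), the other because `c` is
zero off `p + n + q = r`. -/
lemma sum_range_eq_sum_succ {N : ℕ} {u : ℕ → ℂ} (h0 : u 0 = 0) (hN : u N = 0) :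
    ∑ i ∈ Finset.range N, u i = ∑ i ∈ Finset.range N, u (i + 1) := by
  have h1 := Finset.sum_range_succ u N
  have h2 := Finset.sum_range_succ' u N
  rw [hN, add_zero] at h1
  rw [h0, add_zero] at h2
  rw [← h1, h2]

/-- The sum over the exponents `p, n, q ≤ r`. -/
noncomputable def sumExp (r : ℕ) (T : ℕ → ℕ → ℕ → ℂ) : ℂ :=
  ∑ p ∈ Finset.range (r + 1), ∑ n ∈ Finset.range (r + 1), ∑ q ∈ Finset.range (r + 1), T p n q

section sumExp

variable {r : ℕ} {T T' : ℕ → ℕ → ℕ → ℂ}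

lemma sumExp_add : sumExp r (fun p n q => T p n q + T' p n q) = sumExp r T + sumExp r T' := by
  simp only [sumExp, Finset.sum_add_distrib]

lemma sumExp_congr (h : ∀ p n q, T p n q = T' p n q) : sumExp r T = sumExp r T' := by
  simp only [sumExp, h]

lemma mul_sumExp (c : ℂ) : c * sumExp r T = sumExp r (fun p n q => c * T p n q) := by
  simp only [sumExp, Finset.mul_sum]

lemma sumExp_fst (h0 : ∀ n q, T 0 n q = 0) (hr : ∀ n q, T (r + 1) n q = 0) :
    sumExp r T = sumExp r fun p n q => T (p + 1) n q :=
  sum_range_eq_sum_succ (by simp [h0]) (by simp [hr])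

lemma sumExp_snd (h0 : ∀ p q, T p 0 q = 0) (hr : ∀ p q, T p (r + 1) q = 0) :
    sumExp r T = sumExp r fun p n q => T p (n + 1) q :=
  Finset.sum_congr rfl fun p _ => sum_range_eq_sum_succ (by simp [h0]) (by simp [hr])

lemma sumExp_thd (h0 : ∀ p n, T p n 0 = 0) (hr : ∀ p n, T p n (r + 1) = 0) :
    sumExp r T = sumExp r fun p n q => T p n (q + 1) :=
  Finset.sum_congr rfl fun p _ => Finset.sum_congr rfl fun n _ =>
    sum_range_eq_sum_succ (h0 p n) (hr p n)

lemma sumExp_swap : sumExp r T = sumExp r fun p n q => T q n p := by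
  simp only [sumExp]
  rw [Finset.sum_comm]
  rw [Finset.sum_congr rfl fun n _ => Finset.sum_comm]
  rw [Finset.sum_comm]

end sumExp

variable {k r a b : ℕ} {c : ℕ → ℕ → ℕ → ℂ}

/-- The three remainder families come from the exponents `(p+1, n, q)`, `(p, n+2, q-1)` and `(p,
n+1, q)`. After reindexing, all carry the same derivative `D p n q` at index `a + q - p - 1`, and
its total coefficient is the recursion. The relation `p + n + q = r` turns the first factor into `k
+ a + r - 2 - p`. -/
lemma sumExp_lowering (hc : ∀ p n q, p + n + q ≠ r → c p n q = 0)
    (hA : IsLoweringKernel k r a b c) (D : ℕ → ℕ → ℕ → ℤ → ℂ) :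
    sumExp r (fun p n q => c p n q *
      (p * (k + (a + q - p) + (p - 1) + n) * D (p - 1) n q (a + q - p)
        + n * ((n - 1 : ℕ) * D p (n - 1 - 1) (q + 1) (a + q - p))
        + (a + b - (a + q - p) + 1) * (n * D p (n - 1) q (a + q - p - 1)))) = 0 := by
  have h1 : sumExp r (fun p n q => c p n q *
      (p * (k + (a + q - p) + (p - 1) + n) * D (p - 1) n q (a + q - p))) =
      sumExp r fun p n q => (p + 1) * ((k : ℂ) + a + r - 2 - p) * c (p + 1) n q *
        D p n q (a + q - p - 1) := by
    rw [sumExp_fst (by simp) (fun n q => by rw [hc _ _ _ (by omega)]; simp)]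
    refine sumExp_congr fun p n q => ?_
    by_cases h : p + 1 + n + q = r
    · subst h
      rw [show (a + q - (p + 1 : ℕ) : ℤ) = a + q - p - 1 by push_cast; ring, Nat.add_sub_cancel]
      push_cast
      ring
    · simp [hc _ _ _ h]
  have h2 : sumExp r (fun p n q => c p n q *
      (n * ((n - 1 : ℕ) * D p (n - 1 - 1) (q + 1) (a + q - p)))) =
      sumExp r fun p n q => (n + 2) * (n + 1) * prevCoef (c p) n q * D p n q (a + q - p - 1) := by
    rw [sumExp_snd (by simp) (fun n q => by rw [hc _ _ _ (by omega)]; simp),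
      sumExp_snd (by simp) (fun n q => by rw [hc _ _ _ (by omega)]; simp),
      sumExp_thd (T := fun p n q => (n + 2) * (n + 1) * prevCoef (c p) n q *
        D p n q (a + q - p - 1)) (by simp [prevCoef])
        (fun p n => by rw [prevCoef, hc _ _ _ (by omega)]; simp)]
    refine sumExp_congr fun p n q => ?_
    rw [prevCoef, show (a + (q + 1 : ℕ) - p - 1 : ℤ) = a + q - p by push_cast; ring]
    simp only [Nat.add_sub_cancel]
    push_cast
    ring
  have h3 : sumExp r (fun p n q => c p n q *
      ((a + b - (a + q - p) + 1) * (n * D p (n - 1) q (a + q - p - 1)))) =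
      sumExp r fun p n q => (n + 1) * (b + p - q + 1) * c p (n + 1) q *
        D p n q (a + q - p - 1) := by
    rw [sumExp_snd (by simp) (fun n q => by rw [hc _ _ _ (by omega)]; simp)]
    refine sumExp_congr fun p n q => ?_
    rw [Nat.add_sub_cancel]
    push_cast
    ring
  have h := congrArg₂ (· + ·) (congrArg₂ (· + ·) h1 h2) h3
  simp only [← sumExp_add] at h
  refine (sumExp_congr fun p n q => by ring).trans (h.trans ?_)
  have h0 : sumExp r (fun _ _ _ => 0) = 0 := by simp [sumExp]
  rw [← h0]
  refine sumExp_congr fun p n q => ?_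
  linear_combination D p n q (a + q - p - 1) * hA p n q

/-- The action of the lower triangular nilpotent matrix on the coefficients of a function,
up to the sign. -/
noncomputable def lieOp (k l : ℕ) (f : ℤ → (Fin 3 → ℂ) → ℂ) (i : ℤ) (x : Fin 3 → ℂ) : ℂ :=
  (k + i) * (x 0 * f i x) + x 0 * (x 0 * dz 0 (f i) x) + x 0 * (x 1 * dz 1 (f i) x)
    + x 1 * (x 1 * dz 2 (f i) x) + (l - i + 1) * (x 1 * f (i - 1) x)
    + conj (x 0) * (conj (x 0) * dzConj 0 (f i) x) + conj (x 0) * (conj (x 1) * dzConj 1 (f i) x)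
    + conj (x 1) * (conj (x 1) * dzConj 2 (f i) x)

lemma contDiffOn_lieOp {U : Set (Fin 3 → ℂ)} (hU : IsOpen U) {f : ℤ → (Fin 3 → ℂ) → ℂ}
    (hf : ∀ i, ContDiffOn ℝ ∞ (f i) U) {l : ℕ} (i : ℤ) : ContDiffOn ℝ ∞ (lieOp k l f i) U := by
  have c0 := (contDiff_coord 0).contDiffOn (s := U)
  have c1 := (contDiff_coord 1).contDiffOn (s := U)
  have b0 := (contDiff_conj_coord 0).contDiffOn (s := U)
  have b1 := (contDiff_conj_coord 1).contDiffOn (s := U)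
  have d := fun i j => contDiffOn_dz hU (hf i) j
  have e := fun i j => contDiffOn_dzConj hU (hf i) j
  exact (((((((contDiffOn_const.mul (c0.mul (hf i))).add (c0.mul (c0.mul (d i 0)))).add
    (c0.mul (c1.mul (d i 1)))).add (c1.mul (c1.mul (d i 2)))).add
    (contDiffOn_const.mul (c1.mul (hf (i - 1))))).add (b0.mul (b0.mul (e i 0)))).add
    (b0.mul (b1.mul (e i 1)))).add (b1.mul (b1.mul (e i 2)))

/-- Leibniz rule for the polynomial coefficients of `lieOp`. At `x 1 = 0` a factor `x 1` survives
only if some `∂₁₂` hits it, and each such hit lowers `n` by one. -/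
lemma dzMon_lieOp {U : Set (Fin 3 → ℂ)} (hU : IsOpen U) {f : ℤ → (Fin 3 → ℂ) → ℂ}
    (hf : ∀ i, ContDiffOn ℝ ∞ (f i) U) {x : Fin 3 → ℂ} (hx : x ∈ U) (hx1 : x 1 = 0)
    (l p n q : ℕ) (i : ℤ) :
    dzMon p n q (lieOp k l f i) x = (k + i + 2 * p + n) * x 0 * dzMon p n q (f i) x
      + x 0 ^ 2 * dz 0 (dzMon p n q (f i)) x + conj (x 0) ^ 2 * dzConj 0 (dzMon p n q (f i)) x
      + (p * (k + i + (p - 1) + n) * dzMon (p - 1) n q (f i) x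
        + n * ((n - 1 : ℕ) * dzMon p (n - 1 - 1) (q + 1) (f i) x)
        + (l - i + 1) * (n * dzMon p (n - 1) q (f (i - 1)) x)) := by
  have c0 := (contDiff_coord 0).contDiffOn (s := U)
  have c1 := (contDiff_coord 1).contDiffOn (s := U)
  have b0 := (contDiff_conj_coord 0).contDiffOn (s := U)
  have b1 := (contDiff_conj_coord 1).contDiffOn (s := U)
  have d := fun i j => contDiffOn_dz hU (hf i) j
  have e := fun i j => contDiffOn_dzConj hU (hf i) j
  have t1 : ContDiffOn ℝ ∞ (fun x => (k + i : ℂ) * (x 0 * f i x)) U :=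
    contDiffOn_const.mul (c0.mul (hf i))
  have t2 := c0.mul (c0.mul (d i 0))
  have t3 := c0.mul (c1.mul (d i 1))
  have t4 := c1.mul (c1.mul (d i 2))
  have t5 : ContDiffOn ℝ ∞ (fun x => (l - i + 1 : ℂ) * (x 1 * f (i - 1) x)) U :=
    contDiffOn_const.mul (c1.mul (hf (i - 1)))
  have t6 := b0.mul (b0.mul (e i 0))
  have t7 := b0.mul (b1.mul (e i 1))
  have t8 := b1.mul (b1.mul (e i 2))
  unfold lieOp
  rw [dzMon_add hU ((((((t1.add t2).add t3).add t4).add t5).add t6).add t7) t8 hx,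
    dzMon_add hU (((((t1.add t2).add t3).add t4).add t5).add t6) t7 hx,
    dzMon_add hU ((((t1.add t2).add t3).add t4).add t5) t6 hx,
    dzMon_add hU (((t1.add t2).add t3).add t4) t5 hx,
    dzMon_add hU ((t1.add t2).add t3) t4 hx,
    dzMon_add hU (t1.add t2) t3 hx, dzMon_add hU t1 t2 hx,
    dzMon_const_mul hU _ (c0.mul (hf i)) hx, dzMon_const_mul hU _ (c1.mul (hf (i - 1))) hx,
    dzMon_conj_mul hU 0 (b0.mul (e i 0)) hx, dzMon_conj_mul hU 0 (e i 0) hx,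
    dzMon_conj_mul hU 0 (b1.mul (e i 1)) hx, dzMon_conj_mul hU 1 (e i 1) hx,
    dzMon_conj_mul hU 1 (b1.mul (e i 2)) hx, dzMon_coord_zero_mul hU (hf i) hx,
    dzMon_coord_zero_mul hU (c0.mul (d i 0)) hx, dzMon_coord_zero_mul hU (d i 0) hx,
    dzMon_coord_zero_mul hU (d i 0) hx,
    dzMon_coord_zero_mul hU (c1.mul (d i 1)) hx, dzMon_coord_one_mul hU (d i 1) hx,
    dzMon_coord_one_mul hU (d i 1) hx,
    dzMon_coord_one_mul hU (c1.mul (d i 2)) hx, dzMon_coord_one_mul hU (d i 2) hx,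
    dzMon_coord_one_mul hU (d i 2) hx, dzMon_coord_one_mul hU (hf (i - 1)) hx, hx1,
    dzMon_dzConj hU (hf i) 0 hx, dzMon_dz hU (hf i) 0 hx, dzMon_dz_two]
  simp only [map_zero, zero_mul, zero_add, add_zero, mul_zero]
  -- Lowering and raising an exponent cancel except where the subtraction truncates, and there the
  -- factor in front is zero.
  have h1 : (p : ℂ) * dzMon (p - 1) n q (dz 0 (f i)) x = p * dzMon p n q (f i) x := by
    cases p with
    | zero => simp
    | succ p => rw [dzMon_dz_zero hU (hf i) hx, Nat.add_sub_cancel]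
  have h2 : (p : ℂ) * ((p - 1 : ℕ) * dzMon (p - 1 - 1) n q (dz 0 (f i)) x)
      = p * ((p - 1) * dzMon (p - 1) n q (f i) x) := by
    rcases p with _ | _ | p
    · simp
    · simp
    · rw [dzMon_dz_zero hU (hf i) hx]
      rw [show p + 1 + 1 - 1 - 1 + 1 = p + 1 + 1 - 1 from rfl, Nat.add_sub_cancel]
      push_cast
      ring
  have h3 : ∀ p, (n : ℂ) * dzMon p (n - 1) q (dz 1 (f i)) x = n * dzMon p n q (f i) x := by
    intro p
    cases n with
    | zero => simp
    | succ n => rw [dzMon_dz_one hU (hf i) hx, Nat.add_sub_cancel]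
  have h4 := h3 (p - 1)
  have h5 := h3 p
  have h6 : dzMon p (n - 1 - 1) q (dz 2 (f i)) x = dzMon p (n - 1 - 1) (q + 1) (f i) x := rfl
  linear_combination 2 * x 0 * h1 + h2 + p * h4 + x 0 * h5 + n * (n - 1 : ℕ) * h6

/-- The weighted sum of derivatives, as a function on all of Siegel's upper half space. -/
noncomputable def opSum (r a : ℕ) (c : ℕ → ℕ → ℕ → ℂ) (f : ℤ → (Fin 3 → ℂ) → ℂ)
    (x : Fin 3 → ℂ) : ℂ :=
  sumExp r fun p n q => c p n q * dzMon p n q (f (a + q - p)) x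

/-- With `i = a + q - p` and `p + n + q = r`, the factor `k + i + 2p + n` is the constant `k + a +
r`. This makes the main part a slash action of a single weight; the rest cancels by
`sumExp_lowering`. -/
lemma opSum_lieOp (hc : ∀ p n q, p + n + q ≠ r → c p n q = 0) (hA : IsLoweringKernel k r a b c)
    {U : Set (Fin 3 → ℂ)} (hU : IsOpen U) {f : ℤ → (Fin 3 → ℂ) → ℂ}
    (hf : ∀ i, ContDiffOn ℝ ∞ (f i) U) {x : Fin 3 → ℂ} (hx : x ∈ U) (hx1 : x 1 = 0) :
    opSum r a c (lieOp k (a + b) f) x = (k + a + r) * x 0 * opSum r a c f x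
      + x 0 ^ 2 * sumExp r (fun p n q => c p n q * dz 0 (dzMon p n q (f (a + q - p))) x)
      + conj (x 0) ^ 2 *
        sumExp r (fun p n q => c p n q * dzConj 0 (dzMon p n q (f (a + q - p))) x) := by
  have h := sumExp_lowering hc hA fun p n q i => dzMon p n q (f i) x
  rw [← add_zero (_ + _ + _), ← h, opSum, opSum]
  simp only [mul_sumExp, ← sumExp_add]
  refine sumExp_congr fun p n q => ?_
  by_cases hr : p + n + q = r
  · rw [dzMon_lieOp hU hf hx hx1]
    subst hr
    push_cast
    ring
  · simp [hc p n q hr]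

end SiegelDiff

namespace SiegelDiff

/-! ### Siegel's upper half space and the action of the symplectic group -/

lemma posDef_fin_two {u v w : ℝ} :
    (!![u, v; v, w] : Matrix (Fin 2) (Fin 2) ℝ).PosDef ↔ 0 < u ∧ v ^ 2 < u * w := by
  constructor
  · intro h
    have h1 := h.diag_pos (i := 0)
    have h2 := h.det_pos
    rw [Matrix.det_fin_two] at h2
    simp at h1 h2
    exact ⟨h1, by nlinarith⟩
  · rintro ⟨hu, hv⟩
    refine Matrix.PosDef.of_dotProduct_mulVec_pos ?_ fun x hx => ?_
    · ext i j
      fin_cases i <;> fin_cases j <;> simp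
    · have e : star x ⬝ᵥ (!![u, v; v, w] *ᵥ x) =
          u * x 0 ^ 2 + 2 * v * x 0 * x 1 + w * x 1 ^ 2 := by
        simp [dotProduct, Matrix.mulVec, Fin.sum_univ_two]
        ring
      rw [e]
      -- Multiplying by `u` completes the square: `(u x₀ + v x₁)² + (u w - v²) x₁²`.
      refine pos_of_mul_pos_right (a := u) ?_ hu.le
      by_cases h1 : x 1 = 0
      · have h0 : x 0 ≠ 0 := by
          intro h0
          exact hx (by ext i; fin_cases i <;> simp [h0, h1])
        rw [h1]
        have := mul_pos (mul_pos hu hu) (pow_pos (abs_pos.2 h0) 2)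
        rw [sq_abs] at this
        linarith
      · have := mul_pos (sub_pos.2 hv) (pow_pos (abs_pos.2 h1) 2)
        rw [sq_abs] at this
        nlinarith [sq_nonneg (u * x 0 + v * x 1)]

lemma mem_siegelCoord {x : Fin 3 → ℂ} :
    x ∈ siegelCoord ↔ 0 < (x 0).im ∧ (x 1).im ^ 2 < (x 0).im * (x 2).im := by
  have h1 : (symMat x).IsSymm := by
    ext i j
    fin_cases i <;> fin_cases j <;> simp [symMat]
  have h2 : (symMat x).map Complex.im = !![(x 0).im, (x 1).im; (x 1).im, (x 2).im] := by
    ext i j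
    fin_cases i <;> fin_cases j <;> simp [symMat]
  rw [siegelCoord, siegelH2, Set.mem_ofPred_eq, Set.mem_ofPred_eq, h2, posDef_fin_two]
  exact ⟨fun h => h.2, fun h => ⟨h1, h⟩⟩

lemma isOpen_siegelCoord : IsOpen siegelCoord := by
  have h : siegelCoord = {x : Fin 3 → ℂ | 0 < (x 0).im} ∩
      {x | (x 1).im ^ 2 < (x 0).im * (x 2).im} := by
    ext x
    exact mem_siegelCoord
  rw [h]
  exact (isOpen_lt (by fun_prop) (by fun_prop)).inter (isOpen_lt (by fun_prop) (by fun_prop))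

lemma exists_eq_symMat {Z : Matrix (Fin 2) (Fin 2) ℂ} (hZ : Z ∈ siegelH2) :
    ∃ x ∈ siegelCoord, symMat x = Z := by
  have h : symMat ![Z 0 0, Z 0 1, Z 1 1] = Z := by
    have h1 := hZ.1.apply 0 1
    ext i j
    fin_cases i <;> fin_cases j <;> simp [symMat, h1]
  exact ⟨_, by rw [siegelCoord, Set.mem_ofPred_eq, h]; exact hZ, h⟩

lemma diag_mem_siegelCoord {z : ℂ × ℂ} (hz : z ∈ halfPlaneProd) :
    ![z.1, 0, z.2] ∈ siegelCoord := by
  rw [mem_siegelCoord]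
  exact ⟨by simpa using hz.1, by simpa using mul_pos hz.1 hz.2⟩

/-! ### The cocycle relation -/

section cocycle

variable (M N : symplecticGroup (Fin 2) ℝ) {Z : Matrix (Fin 2) (Fin 2) ℂ}

lemma toBlocks_mul :
    (M * N).1.toBlocks₁₁ = M.1.toBlocks₁₁ * N.1.toBlocks₁₁ + M.1.toBlocks₁₂ * N.1.toBlocks₂₁ ∧
    (M * N).1.toBlocks₁₂ = M.1.toBlocks₁₁ * N.1.toBlocks₁₂ + M.1.toBlocks₁₂ * N.1.toBlocks₂₂ ∧
    (M * N).1.toBlocks₂₁ = M.1.toBlocks₂₁ * N.1.toBlocks₁₁ + M.1.toBlocks₂₂ * N.1.toBlocks₂₁ ∧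
    (M * N).1.toBlocks₂₂ = M.1.toBlocks₂₁ * N.1.toBlocks₁₂ + M.1.toBlocks₂₂ * N.1.toBlocks₂₂ := by
  have h : (M * N).1 = fromBlocks M.1.toBlocks₁₁ M.1.toBlocks₁₂ M.1.toBlocks₂₁ M.1.toBlocks₂₂ *
      fromBlocks N.1.toBlocks₁₁ N.1.toBlocks₁₂ N.1.toBlocks₂₁ N.1.toBlocks₂₂ := by
    rw [fromBlocks_toBlocks, fromBlocks_toBlocks]
    rfl
  rw [h, fromBlocks_multiply]
  simp

variable {M N}

lemma numM_mul (h : (denomM N Z).det ≠ 0) :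
    numM (M * N) Z = numM M (actM N Z) * denomM N Z := by
  obtain ⟨h1, h2, -, -⟩ := toBlocks_mul M N
  rw [numM, numM, actM, add_mul, mul_assoc, mul_assoc, Matrix.nonsing_inv_mul _ h.isUnit, mul_one,
    numM, denomM, h1, h2, Matrix.map_add _ (map_add _), Matrix.map_add _ (map_add _)]
  simp only [Matrix.map_mul]
  noncomm_ring

lemma denomM_mul (h : (denomM N Z).det ≠ 0) :
    denomM (M * N) Z = denomM M (actM N Z) * denomM N Z := by
  obtain ⟨-, -, h1, h2⟩ := toBlocks_mul M N
  rw [denomM, denomM, actM, add_mul, mul_assoc, mul_assoc, Matrix.nonsing_inv_mul _ h.isUnit,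
    mul_one, numM, denomM, h1, h2, Matrix.map_add _ (map_add _), Matrix.map_add _ (map_add _)]
  simp only [Matrix.map_mul]
  noncomm_ring

lemma actM_mul (h : (denomM N Z).det ≠ 0) : actM (M * N) Z = actM M (actM N Z) := by
  rw [actM, numM_mul h, denomM_mul h, Matrix.mul_inv_rev, mul_assoc,
    Matrix.mul_nonsing_inv_cancel_left _ _ h.isUnit]
  rfl

lemma substRow_substRow (A B : Matrix (Fin 2) (Fin 2) ℂ) (p : MvPolynomial (Fin 2) ℂ) :
    substRow A (substRow B p) = substRow (A * B) p := by
  have h : (substRow A).comp (substRow B) = substRow (A * B) := by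
    refine MvPolynomial.algHom_ext fun j => ?_
    simp only [AlgHom.comp_apply, substRow, aeval_X, map_mul, Fin.sum_univ_two,
      Matrix.mul_apply, map_add, algHom_C, algebraMap_eq]
    ring
  rw [← h]
  rfl

lemma symPow_symPow {l : ℕ} (A B : Matrix (Fin 2) (Fin 2) ℂ) (p : HomPoly l) :
    symPow l A (symPow l B p) = symPow l (A * B) p :=
  Subtype.ext (substRow_substRow A B p)

lemma slashM_mul {k l : ℕ} (F : Matrix (Fin 2) (Fin 2) ℂ → HomPoly l)
    (h : (denomM N Z).det ≠ 0) :
    slashM k l F (M * N) Z = slashM k l (slashM k l F M) N Z := by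
  simp only [slashM]
  rw [denomM_mul h, actM_mul h, map_smul, symPow_symPow, Matrix.mul_inv_rev, smul_smul,
    Matrix.det_mul, mul_pow, mul_inv, mul_comm]

/-- The automorphy factor of `M` is invertible and `M` preserves Siegel's upper half space. -/
def ActsOnSiegel (M : symplecticGroup (Fin 2) ℝ) : Prop :=
  ∀ Z ∈ siegelH2, (denomM M Z).det ≠ 0 ∧ actM M Z ∈ siegelH2

lemma ActsOnSiegel.mul (hM : ActsOnSiegel M) (hN : ActsOnSiegel N) : ActsOnSiegel (M * N) := by
  intro Z hZ
  have h := hN Z hZ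
  rw [denomM_mul h.1, actM_mul h.1, Matrix.det_mul]
  exact ⟨mul_ne_zero (hM _ h.2).1 h.1, (hM _ h.2).2⟩

end cocycle

/-! ### The embedding of `SL₂ × SL₂` -/

lemma embed_mul (M N M' N' : SL(2, ℝ)) :
    embed (M * M') (N * N') = embed M N * embed M' N' := by
  refine Subtype.ext ?_
  change fromBlocks _ _ _ _ = fromBlocks _ _ _ _ * fromBlocks _ _ _ _
  rw [fromBlocks_multiply, fromBlocks_inj]
  refine ⟨?_, ?_, ?_, ?_⟩ <;> ext i j <;> fin_cases i <;> fin_cases j <;>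
    simp [Matrix.mul_apply, Fin.sum_univ_two]

lemma up_mul (M N : SL(2, ℝ)) : up (M * N) = up M * up N := by
  rw [up, up, up, ← embed_mul, one_mul]

/-- The element of the symplectic group that interchanges the two variables. -/
def swapM : symplecticGroup (Fin 2) ℝ :=
  ⟨fromBlocks !![0, 1; 1, 0] 0 0 !![0, 1; 1, 0], by
    rw [SymplecticGroup.mem_iff, J, fromBlocks_transpose, fromBlocks_multiply,
      fromBlocks_multiply, fromBlocks_inj]
    refine ⟨?_, ?_, ?_, ?_⟩ <;> ext i j <;> fin_cases i <;> fin_cases j <;>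
      simp [vecMul, dotProduct, Fin.sum_univ_two]⟩

/-- This reduces everything about the second variable to the first. -/
lemma down_eq (M : SL(2, ℝ)) : down M = swapM * up M * swapM := by
  refine Subtype.ext ?_
  change fromBlocks _ _ _ _ = fromBlocks _ _ _ _ * fromBlocks _ _ _ _ * fromBlocks _ _ _ _
  rw [fromBlocks_multiply, fromBlocks_multiply, fromBlocks_inj]
  refine ⟨?_, ?_, ?_, ?_⟩ <;> ext i j <;> fin_cases i <;> fin_cases j <;>
    simp [vecMul, dotProduct, Matrix.mul_apply, Fin.sum_univ_two, Matrix.diagonal_apply]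

lemma denomM_swapM (Z : Matrix (Fin 2) (Fin 2) ℂ) : denomM swapM Z = !![0, 1; 1, 0] := by
  ext i j
  fin_cases i <;> fin_cases j <;> simp [denomM, swapM]

lemma inv_swap : (!![0, 1; 1, 0] : Matrix (Fin 2) (Fin 2) ℂ)⁻¹ = !![0, 1; 1, 0] := by
  refine Matrix.inv_eq_right_inv ?_
  ext i j
  fin_cases i <;> fin_cases j <;> simp

lemma actM_swapM (x : Fin 3 → ℂ) :
    actM swapM (symMat x) = symMat ![x 2, x 1, x 0] := by
  rw [actM, denomM_swapM, inv_swap]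
  ext i j
  fin_cases i <;> fin_cases j <;>
    simp [numM, swapM, symMat, Matrix.mul_apply, Fin.sum_univ_two]

lemma reverse_mem_siegelCoord {x : Fin 3 → ℂ} (hx : x ∈ siegelCoord) :
    ![x 2, x 1, x 0] ∈ siegelCoord := by
  rw [mem_siegelCoord] at *
  simp only [Matrix.cons_val]
  exact ⟨pos_of_mul_pos_right ((sq_nonneg _).trans_lt hx.2) hx.1.le, by linarith [hx.2]⟩

lemma actsOnSiegel_swapM : ActsOnSiegel swapM := by
  intro Z hZ
  obtain ⟨x, hx, rfl⟩ := exists_eq_symMat hZ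
  rw [denomM_swapM, actM_swapM]
  exact ⟨by simp, reverse_mem_siegelCoord hx⟩

lemma denomM_up (M : SL(2, ℝ)) (x : Fin 3 → ℂ) :
    denomM (up M) (symMat x) = !![M 1 0 * x 0 + M 1 1, M 1 0 * x 1; 0, 1] := by
  ext i j
  fin_cases i <;> fin_cases j <;>
    simp [denomM, up, embed, symMat, Matrix.mul_apply, Fin.sum_univ_two]

lemma det_denomM_up (M : SL(2, ℝ)) (x : Fin 3 → ℂ) :
    (denomM (up M) (symMat x)).det = M 1 0 * x 0 + M 1 1 := by
  rw [denomM_up, Matrix.det_fin_two]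
  simp

lemma denom_ne_zero_of_im_pos (M : SL(2, ℝ)) {z : ℂ} (hz : 0 < z.im) :
    (M 1 0 * z + M 1 1 : ℂ) ≠ 0 := by
  have := UpperHalfPlane.denom_ne_zero (M : GL (Fin 2) ℝ) ⟨z, hz⟩
  simpa [UpperHalfPlane.denom] using this

/-- The action of `M↑` in coordinates. -/
noncomputable def actUp (M : SL(2, ℝ)) (x : Fin 3 → ℂ) : Fin 3 → ℂ :=
  ![(M 0 0 * x 0 + M 0 1) / (M 1 0 * x 0 + M 1 1), x 1 / (M 1 0 * x 0 + M 1 1),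
    x 2 - M 1 0 * x 1 ^ 2 / (M 1 0 * x 0 + M 1 1)]

lemma coe_det_eq_one (M : SL(2, ℝ)) : M 0 0 * M 1 1 - M 0 1 * M 1 0 = 1 := by
  have := M.det_coe
  rwa [Matrix.det_fin_two] at this

lemma inv_denomM_up (M : SL(2, ℝ)) {x : Fin 3 → ℂ} (hx : (M 1 0 * x 0 + M 1 1 : ℂ) ≠ 0) :
    (denomM (up M) (symMat x))⁻¹ = !![(M 1 0 * x 0 + M 1 1 : ℂ)⁻¹,
      -(M 1 0 * x 1 / (M 1 0 * x 0 + M 1 1)); 0, 1] := by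
  refine Matrix.inv_eq_right_inv ?_
  rw [denomM_up]
  generalize M 1 0 = γ, M 1 1 = δ at hx
  ext i j
  fin_cases i <;> fin_cases j <;> simp [hx]
  field_simp
  ring

lemma actM_up (M : SL(2, ℝ)) {x : Fin 3 → ℂ} (hx : (M 1 0 * x 0 + M 1 1 : ℂ) ≠ 0) :
    actM (up M) (symMat x) = symMat (actUp M x) := by
  have hd : (M 0 0 * M 1 1 - M 0 1 * M 1 0 : ℂ) = 1 := by exact_mod_cast coe_det_eq_one M
  have hn : numM (up M) (symMat x) = !![M 0 0 * x 0 + M 0 1, M 0 0 * x 1; x 1, x 2] := by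
    ext i j
    fin_cases i <;> fin_cases j <;>
      simp [numM, up, embed, symMat, Matrix.mul_apply, Fin.sum_univ_two]
  rw [actM, inv_denomM_up M hx, hn, actUp]
  generalize M 0 0 = α, M 0 1 = β, M 1 0 = γ, M 1 1 = δ at hx hd
  ext i j
  fin_cases i <;> fin_cases j <;>
    simp [symMat, Matrix.mul_apply, Fin.sum_univ_two]
  · ring
  · obtain ⟨j, hj⟩ : ∃ j, j = (γ * x 0 + δ : ℂ) := ⟨_, rfl⟩
    rw [← hj] at hx ⊢
    field_simp
    linear_combination x 1 * hd + α * x 1 * hj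
  · ring
  · ring

/-- Both `Im z₁` and `det (Im Z)` are divided by `|γ z₁ + δ|²`, so positivity is preserved. -/
lemma im_moebius_aux {α β γ δ : ℝ} (hd : α * δ - β * γ = 1) {u v w : ℂ} (hJ : γ * u + δ ≠ 0)
    (hu : 0 < u.im) (hv : v.im ^ 2 < u.im * w.im) :
    0 < ((α * u + β) / (γ * u + δ)).im ∧ (v / (γ * u + δ)).im ^ 2 <
      ((α * u + β) / (γ * u + δ)).im * (w - γ * v ^ 2 / (γ * u + δ)).im := by
  have hN := Complex.normSq_pos.2 hJ
  have hN' : Complex.normSq (γ * u + δ) = (γ * u.re + δ) ^ 2 + (γ * u.im) ^ 2 := by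
    rw [Complex.normSq_apply]
    simp
    ring
  simp only [Complex.div_im, Complex.sub_im]
  generalize Complex.normSq (γ * u + δ) = N at *
  have hN0 := hN.ne'
  simp [pow_two, -sub_pos]
  have h0 : (α * u.im * (γ * u.re + δ) / N - (α * u.re + β) * (γ * u.im) / N) = u.im / N := by
    field_simp
    linear_combination hd
  rw [h0]
  refine ⟨div_pos hu hN, ?_⟩
  have h1 := div_pos (sub_pos.2 hv) hN
  rw [← sub_pos]
  refine h1.trans_eq ?_
  field_simp
  linear_combination -v.im ^ 2 * hN'

lemma actUp_mem (M : SL(2, ℝ)) {x : Fin 3 → ℂ} (hx : x ∈ siegelCoord) :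
    actUp M x ∈ siegelCoord := by
  rw [mem_siegelCoord] at *
  exact im_moebius_aux (coe_det_eq_one M) (denom_ne_zero_of_im_pos M hx.1) hx.1 hx.2

lemma actsOnSiegel_up (M : SL(2, ℝ)) : ActsOnSiegel (up M) := by
  intro Z hZ
  obtain ⟨x, hx, rfl⟩ := exists_eq_symMat hZ
  have h := denom_ne_zero_of_im_pos M (mem_siegelCoord.1 hx).1
  rw [det_denomM_up, actM_up M h]
  exact ⟨h, actUp_mem M hx⟩

end SiegelDiff

namespace SiegelDiff

/-! ### Coefficients of homogeneous polynomials in two variables -/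

lemma bideg_inj {i j i' j' : ℕ} : bideg i j = bideg i' j' ↔ i = i' ∧ j = j' := by
  constructor
  · intro h
    have h0 := DFunLike.congr_fun h 0
    have h1 := DFunLike.congr_fun h 1
    simp [bideg] at h0 h1
    exact ⟨h0, h1⟩
  · rintro ⟨rfl, rfl⟩
    rfl

lemma eq_bideg (n : Fin 2 →₀ ℕ) : n = bideg (n 0) (n 1) := by
  ext i
  fin_cases i <;> simp [bideg]

lemma C_mul_X_pow_mul_X_pow (c : ℂ) (i j : ℕ) :
    (C c * (X 0 ^ i * X 1 ^ j) : MvPolynomial (Fin 2) ℂ) = monomial (bideg i j) c := by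
  rw [X_pow_eq_monomial, X_pow_eq_monomial, monomial_mul, C_mul_monomial, bideg]
  simp

lemma coeff_bideg_mul (c : ℂ) (i j i' j' : ℕ) :
    coeff (bideg i' j') (C c * (X 0 ^ i * X 1 ^ j) : MvPolynomial (Fin 2) ℂ) =
      if i = i' ∧ j = j' then c else 0 := by
  rw [C_mul_X_pow_mul_X_pow, coeff_monomial]
  simp only [bideg_inj]

lemma coeff_bideg_sum {l : ℕ} (c : ℕ × ℕ → ℂ) {i j : ℕ} (h : i + j = l) :
    coeff (bideg i j) (∑ ij ∈ Finset.HasAntidiagonal.antidiagonal l,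
      C (c ij) * (X 0 ^ ij.1 * X 1 ^ ij.2) : MvPolynomial (Fin 2) ℂ) = c (i, j) := by
  rw [coeff_sum, Finset.sum_eq_single (i, j)]
  · rw [coeff_bideg_mul, if_pos ⟨rfl, rfl⟩]
  · intro b _ hb
    rw [coeff_bideg_mul, if_neg]
    rintro ⟨rfl, rfl⟩
    exact hb rfl
  · intro hb
    exact absurd (Finset.HasAntidiagonal.mem_antidiagonal.2 h) hb

lemma coeff_eq_zero_of_homPoly {l : ℕ} (p : HomPoly l) {n : Fin 2 →₀ ℕ} (h : n 0 + n 1 ≠ l) :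
    coeff n p.1 = 0 := by
  refine ((mem_homogeneousSubmodule l p.1).1 p.2).coeff_eq_zero ?_
  simpa [Finsupp.degree_eq_sum, Fin.sum_univ_two] using h

lemma homPoly_eq_sum {l : ℕ} (p : HomPoly l) :
    p.1 = ∑ ij ∈ Finset.HasAntidiagonal.antidiagonal l,
      C (coeff (bideg ij.1 ij.2) p.1) * (X 0 ^ ij.1 * X 1 ^ ij.2) := by
  ext n
  by_cases h : n 0 + n 1 = l
  · rw [eq_bideg n, coeff_bideg_sum (fun ij => coeff (bideg ij.1 ij.2) p.1) h]
  · rw [coeff_eq_zero_of_homPoly p h, coeff_sum, eq_bideg n]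
    refine (Finset.sum_eq_zero fun ij hij => ?_).symm
    rw [coeff_bideg_mul, if_neg]
    rintro ⟨h1, h2⟩
    exact h (by rw [← h1, ← h2]; exact Finset.HasAntidiagonal.mem_antidiagonal.1 hij)

/-- The coefficient of `X₁ ^ i * X₂ ^ (l - i)`, extended by zero. -/
noncomputable def coordFun {l : ℕ} (F : Matrix (Fin 2) (Fin 2) ℂ → HomPoly l) (i : ℤ)
    (x : Fin 3 → ℂ) : ℂ :=
  if 0 ≤ i ∧ i ≤ l then coeff (bideg i.toNat (l - i).toNat) (F (symMat x)).1 else 0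

lemma coordFun_of_add_eq {l i j : ℕ} (F : Matrix (Fin 2) (Fin 2) ℂ → HomPoly l) (h : i + j = l) :
    coordFun F i = fun x => coeff (bideg i j) (F (symMat x)).1 := by
  ext x
  rw [coordFun, if_pos ⟨by positivity, by exact_mod_cast (by omega : i ≤ l)⟩]
  congr
  omega

lemma coordFun_of_not {l : ℕ} (F : Matrix (Fin 2) (Fin 2) ℂ → HomPoly l) {i : ℤ}
    (h : ¬ (0 ≤ i ∧ i ≤ l)) : coordFun F i = fun _ => 0 := by
  ext x
  rw [coordFun, if_neg h]

lemma IsSmooth.contDiffOn_coordFun {l : ℕ} {F : Matrix (Fin 2) (Fin 2) ℂ → HomPoly l}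
    (hF : IsSmooth F) (i : ℤ) : ContDiffOn ℝ ∞ (coordFun F i) siegelCoord := by
  by_cases h : 0 ≤ i ∧ i ≤ l
  · exact (hF _).congr fun x _ => if_pos h
  · rw [coordFun_of_not F h]
    exact contDiffOn_const

/-! ### The operator in coordinates -/

/-- The exponent of `∂₁^p ∂₁₂^n ∂₂^q`. -/
noncomputable def triExp (t : ℕ × ℕ × ℕ) : Fin 3 →₀ ℕ :=
  Finsupp.equivFunOnFinite.symm ![t.1, t.2.1, t.2.2]

lemma triExp_injective : Function.Injective triExp := by
  intro s t h
  have h0 := DFunLike.congr_fun h 0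
  have h1 := DFunLike.congr_fun h 1
  have h2 := DFunLike.congr_fun h 2
  simp [triExp] at h0 h1 h2
  exact Prod.ext h0 (Prod.ext h1 h2)

/-- The polynomial with given coefficients of degree at most `r` in each variable. -/
noncomputable def triPoly (r : ℕ) (c : ℕ → ℕ → ℕ → ℂ) : MvPolynomial (Fin 3) ℂ :=
  ∑ t ∈ Finset.range (r + 1) ×ˢ Finset.range (r + 1) ×ˢ Finset.range (r + 1),
    monomial (triExp t) (c t.1 t.2.1 t.2.2)

lemma coeff_triPoly {r : ℕ} (c : ℕ → ℕ → ℕ → ℂ) {t : ℕ × ℕ × ℕ}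
    (ht : t ∈ Finset.range (r + 1) ×ˢ Finset.range (r + 1) ×ˢ Finset.range (r + 1)) :
    coeff (triExp t) (triPoly r c) = c t.1 t.2.1 t.2.2 := by
  rw [triPoly, coeff_sum, Finset.sum_eq_single t]
  · simp
  · intro s _ hs
    rw [coeff_monomial, if_neg (triExp_injective.ne hs)]
  · exact fun h => absurd ht h

lemma isHomogeneous_triPoly {r : ℕ} {c : ℕ → ℕ → ℕ → ℂ}
    (hc : ∀ p n q, p + n + q ≠ r → c p n q = 0) : (triPoly r c).IsHomogeneous r := by
  refine IsHomogeneous.sum _ _ _ fun t _ => ?_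
  by_cases h : t.1 + t.2.1 + t.2.2 = r
  · refine isHomogeneous_monomial _ ?_
    simpa [triExp, Finsupp.degree_eq_sum, Fin.sum_univ_three] using h
  · rw [hc _ _ _ h, monomial_zero]
    exact isHomogeneous_zero _ _ _

lemma sum_support_triPoly {r : ℕ} (c : ℕ → ℕ → ℕ → ℂ) (T : (Fin 3 →₀ ℕ) → ℂ) :
    ∑ m ∈ (triPoly r c).support, coeff m (triPoly r c) * T m =
      sumExp r fun p n q => c p n q * T (triExp (p, n, q)) := by
  have hs : (triPoly r c).support ⊆
      (Finset.range (r + 1) ×ˢ Finset.range (r + 1) ×ˢ Finset.range (r + 1)).image triExp := by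
    intro m hm
    by_contra h
    rw [mem_support_iff, triPoly, coeff_sum] at hm
    refine hm (Finset.sum_eq_zero fun t ht => ?_)
    rw [coeff_monomial, if_neg]
    rintro rfl
    exact h (Finset.mem_image_of_mem _ ht)
  rw [Finset.sum_subset hs (fun m _ hm => by rw [notMem_support_iff.1 hm, zero_mul]),
    Finset.sum_image triExp_injective.injOn, sumExp, Finset.sum_product]
  simp only [Finset.sum_product]
  refine Finset.sum_congr rfl fun p hp => Finset.sum_congr rfl fun n hn =>
    Finset.sum_congr rfl fun q hq => ?_
  rw [coeff_triPoly]
  simp only [Finset.mem_product]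
  exact ⟨hp, hn, hq⟩

/-- For `p + n + q = r` the two degree conditions force `ij = (a + q - p, b + p - q)`. If `a + q -
p` lies outside `[0, l]`, no monomial contributes, which agrees with the extension of `coordFun` by
zero. -/
lemma diagOp_triPoly {r a b l : ℕ} (hl : l = a + b) {c : ℕ → ℕ → ℕ → ℂ}
    (hc : ∀ p n q, p + n + q ≠ r → c p n q = 0) (F : Matrix (Fin 2) (Fin 2) ℂ → HomPoly l)
    (z : ℂ × ℂ) :
    diagOp r a b (triPoly r c) F z = opSum r a c (coordFun F) ![z.1, 0, z.2] := by
  have h : diagOp r a b (triPoly r c) F z = ∑ m ∈ (triPoly r c).support,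
      coeff m (triPoly r c) * ∑ ij ∈ Finset.HasAntidiagonal.antidiagonal l,
        if 2 * m 0 + m 1 + ij.1 = a + r ∧ m 1 + 2 * m 2 + ij.2 = b + r then
          dzIter m (fun y => coeff (bideg ij.1 ij.2) (F (symMat y)).1) ![z.1, 0, z.2] else 0 := by
    rw [diagOp, applyOp, coeff_sum]
    refine Finset.sum_congr rfl fun m _ => ?_
    rw [Finset.mul_sum, Finset.mul_sum, coeff_sum]
    refine Finset.sum_congr rfl fun ij _ => ?_
    rw [mul_ite, mul_zero, ← coeff_bideg_mul]
    congr 1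
    rw [C_mul]
    ring
  rw [h, sum_support_triPoly, opSum]
  refine sumExp_congr fun p n q => ?_
  by_cases hr : p + n + q = r
  · congr 1
    have e : ∀ G, dzIter (triExp (p, n, q)) G = dzMon p n q G := fun G => by
      simp [dzIter, dzMon, triExp]
    simp only [e]
    have e0 : triExp (p, n, q) 0 = p := by simp [triExp]
    have e1 : triExp (p, n, q) 1 = n := by simp [triExp]
    have e2 : triExp (p, n, q) 2 = q := by simp [triExp]
    rw [e0, e1, e2]
    by_cases hw : 0 ≤ (a + q - p : ℤ) ∧ (a + q - p : ℤ) ≤ l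
    · rw [Finset.sum_eq_single (a + q - p, b + p - q), if_pos ⟨by omega, by omega⟩,
        ← coordFun_of_add_eq F (by omega : (a + q - p) + (b + p - q) = l)]
      · congr 2
        omega
      · rintro ⟨i, j⟩ hij hne
        rw [if_neg]
        rintro ⟨h1, h2⟩
        refine hne (Prod.ext ?_ ?_)
        · simp only at h1 h2 ⊢
          omega
        · simp only at h1 h2 ⊢
          omega
      · intro hn
        refine absurd (Finset.HasAntidiagonal.mem_antidiagonal.2 ?_) hn
        simp only
        omega
    · rw [coordFun_of_not F hw, dzMon_zero]
      refine Finset.sum_eq_zero fun ij hij => if_neg ?_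
      rintro ⟨h1, h2⟩
      have := Finset.HasAntidiagonal.mem_antidiagonal.1 hij
      omega
  · rw [hc p n q hr, zero_mul, zero_mul]

end SiegelDiff

namespace SiegelDiff

open ComplexConjugate

/-! ### The slash operator in coordinates -/

lemma substRow_mul_pow (A : Matrix (Fin 2) (Fin 2) ℂ) (c : ℂ) (i j : ℕ) :
    substRow A (C c * (X 0 ^ i * X 1 ^ j)) =
      C c * ((X 0 * C (A 0 0) + X 1 * C (A 1 0)) ^ i * (X 0 * C (A 0 1) + X 1 * C (A 1 1)) ^ j) := by
  simp [substRow, Fin.sum_univ_two, algebraMap_eq]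

/-- The automorphy factor of `M↑`. -/
noncomputable def autUp (M : SL(2, ℝ)) (x : Fin 3 → ℂ) : ℂ := M 1 0 * x 0 + M 1 1

lemma slashM_up {k l : ℕ} (F : Matrix (Fin 2) (Fin 2) ℂ → HomPoly l) (M : SL(2, ℝ))
    {x : Fin 3 → ℂ} (hx : x ∈ siegelCoord) :
    (slashM k l F (up M) (symMat x)).1 = ∑ ij ∈ Finset.HasAntidiagonal.antidiagonal l,
      C (((autUp M x) ^ k)⁻¹ * coeff (bideg ij.1 ij.2) (F (symMat (actUp M x))).1
        * (autUp M x)⁻¹ ^ ij.1) *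
          (X 0 ^ ij.1 * (X 0 * C (-(M 1 0 * x 1 / autUp M x)) + X 1) ^ ij.2) := by
  have h := denom_ne_zero_of_im_pos M (mem_siegelCoord.1 hx).1
  have e : (slashM k l F (up M) (symMat x)).1 = C ((autUp M x) ^ k)⁻¹ *
      substRow (denomM (up M) (symMat x))⁻¹ (F (symMat (actUp M x))).1 := by
    rw [slashM, det_denomM_up, actM_up M h, ← smul_eq_C_mul]
    rfl
  rw [e, inv_denomM_up M h, homPoly_eq_sum (F (symMat (actUp M x))), map_sum, Finset.mul_sum]
  refine Finset.sum_congr rfl fun ij _ => ?_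
  rw [substRow_mul_pow]
  simp only [← homPoly_eq_sum, autUp, C_mul, Matrix.of_apply, Matrix.cons_val', Matrix.cons_val,
    C_0, C_1, mul_zero, mul_one, add_zero, mul_pow, C_pow]
  ring

/-! ### Smooth dependence of the slash operator on the point and the matrix. -/

section smooth

variable {E : Type*} [NormedAddCommGroup E] [NormedSpace ℝ E] {U : Set E}

/-- All coefficients of a polynomial depending on a parameter are smooth. -/
def CoeffSmoothOn (p : E → MvPolynomial (Fin 2) ℂ) (U : Set E) : Prop :=
  ∀ n, ContDiffOn ℝ ∞ (fun y => coeff n (p y)) U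

lemma CoeffSmoothOn.add {p q : E → MvPolynomial (Fin 2) ℂ} (hp : CoeffSmoothOn p U)
    (hq : CoeffSmoothOn q U) : CoeffSmoothOn (fun y => p y + q y) U := fun n => by
  simp only [coeff_add]
  exact (hp n).add (hq n)

lemma CoeffSmoothOn.mul {p q : E → MvPolynomial (Fin 2) ℂ} (hp : CoeffSmoothOn p U)
    (hq : CoeffSmoothOn q U) : CoeffSmoothOn (fun y => p y * q y) U := fun n => by
  simp only [coeff_mul]
  exact ContDiffOn.sum fun m _ => (hp m.1).mul (hq m.2)

lemma CoeffSmoothOn.sum {ι : Type*} {s : Finset ι} {p : ι → E → MvPolynomial (Fin 2) ℂ}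
    (hp : ∀ i ∈ s, CoeffSmoothOn (p i) U) : CoeffSmoothOn (fun y => ∑ i ∈ s, p i y) U := fun n => by
  simp only [coeff_sum]
  exact ContDiffOn.sum fun i hi => hp i hi n

lemma coeffSmoothOn_const (p : MvPolynomial (Fin 2) ℂ) : CoeffSmoothOn (fun _ : E => p) U :=
  fun _ => contDiffOn_const

lemma coeffSmoothOn_C {g : E → ℂ} (hg : ContDiffOn ℝ ∞ g U) : CoeffSmoothOn (fun y => C (g y)) U :=
  fun n => by
  by_cases h : 0 = n
  · simpa [coeff_C, h] using hg
  · simpa [coeff_C, h] using contDiffOn_const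

lemma CoeffSmoothOn.pow {p : E → MvPolynomial (Fin 2) ℂ} (hp : CoeffSmoothOn p U) (m : ℕ) :
    CoeffSmoothOn (fun y => p y ^ m) U := by
  induction m with
  | zero => simpa using coeffSmoothOn_const 1
  | succ m ih => simpa only [pow_succ] using ih.mul hp

/-- The matrix may vary with the parameter: a constant matrix gives smoothness of `F | M↑`, and the
family `lowerUni s` gives joint smoothness in `(s, x)`. -/
lemma coeffSmoothOn_slashM_up {k l : ℕ} {F : Matrix (Fin 2) (Fin 2) ℂ → HomPoly l}
    (hF : IsSmooth F) {M : E → SL(2, ℝ)} {x : E → Fin 3 → ℂ}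
    (hM : ∀ i j, ContDiffOn ℝ ∞ (fun y => M y i j) U)
    (hx : ∀ i, ContDiffOn ℝ ∞ (fun y => x y i) U) (hxU : ∀ y ∈ U, x y ∈ siegelCoord) :
    CoeffSmoothOn (fun y => (slashM k l F (up (M y)) (symMat (x y))).1) U := by
  have hM' : ∀ i j, ContDiffOn ℝ ∞ (fun y => (M y i j : ℂ)) U := fun i j =>
    Complex.ofRealCLM.contDiff.comp_contDiffOn (hM i j)
  have hJ : ContDiffOn ℝ ∞ (fun y => autUp (M y) (x y)) U :=
    ((hM' 1 0).mul (hx 0)).add (hM' 1 1)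
  have hJ0 : ∀ y ∈ U, autUp (M y) (x y) ≠ 0 := fun y hy =>
    denom_ne_zero_of_im_pos (M y) (mem_siegelCoord.1 (hxU y hy)).1
  have hact : ContDiffOn ℝ ∞ (fun y => actUp (M y) (x y)) U := by
    refine contDiffOn_pi.2 fun i => ?_
    fin_cases i
    · exact (((hM' 0 0).mul (hx 0)).add (hM' 0 1)).mul (hJ.inv hJ0)
    · exact (hx 1).mul (hJ.inv hJ0)
    · exact (hx 2).sub (((hM' 1 0).mul ((hx 1).pow 2)).mul (hJ.inv hJ0))
  have hF' : ∀ n, ContDiffOn ℝ ∞ (fun y => coeff n (F (symMat (actUp (M y) (x y)))).1) U :=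
    fun n => (hF n).comp hact fun y hy => actUp_mem (M y) (hxU y hy)
  have hs : CoeffSmoothOn (fun y => ∑ ij ∈ Finset.HasAntidiagonal.antidiagonal l,
      C (((autUp (M y) (x y)) ^ k)⁻¹ * coeff (bideg ij.1 ij.2) (F (symMat (actUp (M y) (x y)))).1
        * (autUp (M y) (x y))⁻¹ ^ ij.1) *
          (X 0 ^ ij.1 * (X 0 * C (-(M y 1 0 * x y 1 / autUp (M y) (x y))) + X 1) ^ ij.2)) U := by
    refine CoeffSmoothOn.sum fun ij _ => (coeffSmoothOn_C ?_).mul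
      ((coeffSmoothOn_const _).mul (CoeffSmoothOn.pow
        (((coeffSmoothOn_const _).mul (coeffSmoothOn_C ?_)).add (coeffSmoothOn_const _)) _))
    · exact (((hJ.pow k).inv fun y hy => pow_ne_zero _ (hJ0 y hy)).mul (hF' _)).mul
        ((hJ.inv hJ0).pow _)
    · exact (((hM' 1 0).mul (hx 1)).mul (hJ.inv hJ0)).neg
  intro n
  refine (hs n).congr fun y hy => ?_
  simp only [slashM_up F (M y) (hxU y hy)]

end smooth

lemma IsSmooth.slashM_up {k l : ℕ} {F : Matrix (Fin 2) (Fin 2) ℂ → HomPoly l}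
    (hF : IsSmooth F) (M : SL(2, ℝ)) : IsSmooth (slashM k l F (up M)) :=
  coeffSmoothOn_slashM_up (M := fun _ => M) (x := fun x => x) hF (fun _ _ => contDiffOn_const)
    (fun i => (contDiff_coord i).contDiffOn) fun _ h => h

/-! ### The derivative along the lower triangular unipotent matrices -/

/-- The lower triangular unipotent matrix with entry `s`. -/
def lowerUni (s : ℝ) : SL(2, ℝ) := ⟨!![1, 0; s, 1], by simp [Matrix.det_fin_two]⟩

lemma lowerUni_add (s t : ℝ) : lowerUni (s + t) = lowerUni s * lowerUni t := by
  refine Subtype.ext ?_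
  change !![1, 0; s + t, 1] = !![1, 0; s, 1] * !![1, 0; t, 1]
  ext i j
  fin_cases i <;> fin_cases j <;> simp

lemma lowerUni_zero : lowerUni 0 = 1 := by
  refine Subtype.ext ?_
  change !![1, 0; 0, 1] = 1
  ext i j
  fin_cases i <;> fin_cases j <;> simp

lemma autUp_lowerUni (s : ℝ) (x : Fin 3 → ℂ) : autUp (lowerUni s) x = s * x 0 + 1 := by
  simp [autUp, lowerUni]

lemma actUp_lowerUni (s : ℝ) (x : Fin 3 → ℂ) : actUp (lowerUni s) x =
    ![x 0 / (s * x 0 + 1), x 1 / (s * x 0 + 1), x 2 - s * x 1 ^ 2 / (s * x 0 + 1)] := by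
  simp [actUp, lowerUni]

lemma hasDerivAt_autUp (c : ℂ) : HasDerivAt (fun s : ℝ => (s * c + 1 : ℂ)) c 0 := by
  simpa using ((Complex.ofRealCLM.hasDerivAt (x := (0 : ℝ))).mul_const c).add_const 1

lemma hasDerivAt_inv_autUp (c : ℂ) : HasDerivAt (fun s : ℝ => (s * c + 1 : ℂ)⁻¹) (-c) 0 := by
  simpa using (hasDerivAt_autUp c).fun_inv (by simp)

lemma hasDerivAt_inv_autUp_pow (c : ℂ) (m : ℕ) :
    HasDerivAt (fun s : ℝ => (s * c + 1 : ℂ)⁻¹ ^ m) (-(m * c)) 0 := by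
  simpa using (hasDerivAt_inv_autUp c).fun_pow m

lemma hasDerivAt_actUp (x : Fin 3 → ℂ) : HasDerivAt (fun s => actUp (lowerUni s) x)
    ![-x 0 ^ 2, -(x 0 * x 1), -x 1 ^ 2] 0 := by
  simp only [actUp_lowerUni, div_eq_mul_inv]
  refine hasDerivAt_pi.2 fun i => ?_
  fin_cases i
  · simpa [pow_two] using (hasDerivAt_inv_autUp (x 0)).const_mul (x 0)
  · simpa [mul_comm] using (hasDerivAt_inv_autUp (x 0)).const_mul (x 1)
  · have h := (((Complex.ofRealCLM.hasDerivAt (x := (0 : ℝ))).mul_const (x 1 ^ 2)).mul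
      (hasDerivAt_inv_autUp (x 0))).const_sub (x 2)
    simpa using h

/-- All coefficients of a family of polynomials are differentiable at zero. -/
def HasCoeffDerivAtZero (p : ℝ → MvPolynomial (Fin 2) ℂ) (p' : MvPolynomial (Fin 2) ℂ) : Prop :=
  ∀ n, HasDerivAt (fun s => coeff n (p s)) (coeff n p') 0

lemma HasCoeffDerivAtZero.mul {p q : ℝ → MvPolynomial (Fin 2) ℂ} {p' q' : MvPolynomial (Fin 2) ℂ}
    (hp : HasCoeffDerivAtZero p p') (hq : HasCoeffDerivAtZero q q') :
    HasCoeffDerivAtZero (fun s => p s * q s) (p' * q 0 + p 0 * q') := fun n => by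
  simp only [coeff_mul, coeff_add, ← Finset.sum_add_distrib]
  exact HasDerivAt.fun_sum fun m _ => (hp m.1).fun_mul (hq m.2)

lemma HasCoeffDerivAtZero.sum {ι : Type*} {s : Finset ι} {p : ι → ℝ → MvPolynomial (Fin 2) ℂ}
    {p' : ι → MvPolynomial (Fin 2) ℂ} (hp : ∀ i ∈ s, HasCoeffDerivAtZero (p i) (p' i)) :
    HasCoeffDerivAtZero (fun t => ∑ i ∈ s, p i t) (∑ i ∈ s, p' i) := fun n => by
  simp only [coeff_sum]
  exact HasDerivAt.fun_sum fun i hi => hp i hi n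

lemma hasCoeffDerivAtZero_C {g : ℝ → ℂ} {g' : ℂ} (hg : HasDerivAt g g' 0) :
    HasCoeffDerivAtZero (fun s => C (g s)) (C g') := fun n => by
  by_cases h : 0 = n
  · simpa [coeff_C, h] using hg
  · simpa [coeff_C, h] using hasDerivAt_const (0 : ℝ) (0 : ℂ)

lemma hasCoeffDerivAtZero_const (p : MvPolynomial (Fin 2) ℂ) :
    HasCoeffDerivAtZero (fun _ => p) 0 := fun n => by
  simpa using hasDerivAt_const (0 : ℝ) (coeff n p)

lemma HasCoeffDerivAtZero.pow {p : ℝ → MvPolynomial (Fin 2) ℂ} {p' : MvPolynomial (Fin 2) ℂ}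
    (hp : HasCoeffDerivAtZero p p') (m : ℕ) :
    HasCoeffDerivAtZero (fun s => p s ^ m) (m * p 0 ^ (m - 1) * p') := by
  induction m with
  | zero => simpa using hasCoeffDerivAtZero_const 1
  | succ m ih =>
    have h := ih.mul hp
    simp only [← pow_succ] at h
    convert h using 1
    cases m with
    | zero => simp
    | succ m =>
      simp only [Nat.add_sub_cancel]
      push_cast
      ring

lemma HasCoeffDerivAtZero.add_const {p : ℝ → MvPolynomial (Fin 2) ℂ}
    {p' : MvPolynomial (Fin 2) ℂ} (hp : HasCoeffDerivAtZero p p') (q : MvPolynomial (Fin 2) ℂ) :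
    HasCoeffDerivAtZero (fun s => p s + q) p' := fun n => by
  simpa using (hp n).add_const (coeff n q)

lemma hasCoeffDerivAtZero_slashM {k l : ℕ} {F : Matrix (Fin 2) (Fin 2) ℂ → HomPoly l}
    (hF : IsSmooth F) {x : Fin 3 → ℂ} (hx : x ∈ siegelCoord) :
    HasCoeffDerivAtZero (fun s => (slashM k l F (up (lowerUni s)) (symMat x)).1)
      (∑ ij ∈ Finset.HasAntidiagonal.antidiagonal l,
        (C (fderiv ℝ (fun y => coeff (bideg ij.1 ij.2) (F (symMat y)).1) x
            ![-x 0 ^ 2, -(x 0 * x 1), -x 1 ^ 2]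
          - (k + ij.1) * x 0 * coeff (bideg ij.1 ij.2) (F (symMat x)).1)
            * (X 0 ^ ij.1 * X 1 ^ ij.2)
          + C (-(ij.2 * x 1 * coeff (bideg ij.1 ij.2) (F (symMat x)).1)) *
            (X 0 ^ (ij.1 + 1) * X 1 ^ (ij.2 - 1)))) := by
  simp only [SiegelDiff.slashM_up F _ hx, autUp_lowerUni]
  refine HasCoeffDerivAtZero.sum fun ij _ => ?_
  have ha0 : actUp (lowerUni 0) x = x := by
    rw [actUp_lowerUni]
    ext i
    fin_cases i <;> simp
  have hg : HasDerivAt (fun s => coeff (bideg ij.1 ij.2) (F (symMat (actUp (lowerUni s) x))).1)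
      (fderiv ℝ (fun y => coeff (bideg ij.1 ij.2) (F (symMat y)).1) x
        ![-x 0 ^ 2, -(x 0 * x 1), -x 1 ^ 2]) 0 := by
    have h1 := (differentiableAt_of_contDiffOn isOpen_siegelCoord (hF (bideg ij.1 ij.2))
      hx).hasFDerivAt
    rw [← ha0] at h1
    have := h1.comp_hasDerivAt 0 (hasDerivAt_actUp x)
    rwa [ha0] at this
  have h1 := ((hasDerivAt_inv_autUp_pow (x 0) k).fun_mul hg).fun_mul
    (hasDerivAt_inv_autUp_pow (x 0) ij.1)
  have ht : HasDerivAt (fun s : ℝ => -((lowerUni s 1 0 : ℝ) * x 1 / (s * x 0 + 1) : ℂ)) (-x 1) 0 := by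
    have h := (((Complex.ofRealCLM.hasDerivAt (x := (0 : ℝ))).mul_const (x 1)).fun_mul
      (hasDerivAt_inv_autUp (x 0))).fun_neg
    simpa [lowerUni, div_eq_mul_inv] using h
  have h := (hasCoeffDerivAtZero_C h1).mul ((hasCoeffDerivAtZero_const (X 0 ^ ij.1)).mul
    ((((hasCoeffDerivAtZero_const (X 0)).mul (hasCoeffDerivAtZero_C ht)).add_const (X 1)).pow ij.2))
  have hl : (lowerUni 0 1 0 : ℝ) = 0 := rfl
  convert h using 1
  · simp only [inv_pow]
  · simp only [ha0, hl, Complex.ofReal_zero, zero_mul, zero_add, zero_div, one_pow, inv_one, mul_one,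
      one_mul, neg_zero, C_0, mul_zero, C_neg, C_mul, C_sub, C_add, map_natCast]
    ring

/-- This identifies `-lieOp` as the derivative of the slash action. The `f (i - 1)` term arises
because the substitution adds a multiple of `X₁` to `X₂`. -/
lemma hasDerivAt_coordFun_slashM {k l : ℕ} {F : Matrix (Fin 2) (Fin 2) ℂ → HomPoly l}
    (hF : IsSmooth F) {x : Fin 3 → ℂ} (hx : x ∈ siegelCoord) (i : ℤ) :
    HasDerivAt (fun s => coordFun (slashM k l F (up (lowerUni s))) i x)
      (-lieOp k l (coordFun F) i x) 0 := by
  by_cases hi : 0 ≤ i ∧ i ≤ l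
  · obtain ⟨i, rfl⟩ := Int.eq_ofNat_of_zero_le hi.1
    obtain ⟨j, hj⟩ := Nat.exists_eq_add_of_le (Int.ofNat_le.1 hi.2)
    have hij : i + j = l := hj.symm
    have h := hasCoeffDerivAtZero_slashM (k := k) hF hx (bideg i j)
    simp only [coordFun_of_add_eq _ hij]
    convert h using 1
    rw [Finset.sum_add_distrib, coeff_add, coeff_bideg_sum (fun ij : ℕ × ℕ =>
      fderiv ℝ (fun y => coeff (bideg ij.1 ij.2) (F (symMat y)).1) x
        ![-x 0 ^ 2, -(x 0 * x 1), -x 1 ^ 2]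
        - (k + ij.1) * x 0 * coeff (bideg ij.1 ij.2) (F (symMat x)).1) hij]
    have h2 : coeff (bideg i j) (∑ ij ∈ Finset.HasAntidiagonal.antidiagonal l,
        C (-(ij.2 * x 1 * coeff (bideg ij.1 ij.2) (F (symMat x)).1)) *
            (X 0 ^ (ij.1 + 1) * X 1 ^ (ij.2 - 1)) : MvPolynomial (Fin 2) ℂ) =
        -((l - i + 1) * (x 1 * coordFun F (i - 1) x)) := by
      rw [coeff_sum]
      simp only [coeff_bideg_mul]
      cases i with
      | zero =>
        rw [coordFun_of_not F (by simp), Finset.sum_eq_zero]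
        · simp
        · intro ij _
          rw [if_neg]
          simp
      | succ i =>
        rw [show ((i + 1 : ℕ) : ℤ) - 1 = (i : ℕ) by push_cast; ring,
          coordFun_of_add_eq F (by omega : i + (j + 1) = l), Finset.sum_eq_single (i, j + 1)]
        · have hlC : (l : ℂ) = (i + 1 : ℕ) + j := by exact_mod_cast hj
          rw [if_pos ⟨rfl, by simp⟩, hlC]
          push_cast
          ring
        · rintro ⟨i', j'⟩ hm hne
          have hm' := Finset.HasAntidiagonal.mem_antidiagonal.1 hm
          -- Because of truncation, `j' - 1 = j` could also hold with `j' = 0`; such a term is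
          -- killed by its factor `ij.2`.
          by_cases hc : i' + 1 = i + 1 ∧ j' - 1 = j
          · have : j' = 0 := by
              by_contra h0
              exact hne (Prod.ext (by simp only; omega) (by simp only; omega))
            simp [this]
          · exact if_neg hc
        · intro hn
          exact absurd (Finset.HasAntidiagonal.mem_antidiagonal.2 (by simp only; omega)) hn
    rw [h2, fderiv_eq_sum_dz, lieOp, coordFun_of_add_eq F hij, Fin.sum_univ_three]
    simp only [Matrix.cons_val, map_neg, map_mul, map_pow]
    push_cast
    ring
  · have h0 : lieOp k l (coordFun F) i x = 0 := by
      have h1 : coordFun F i = fun _ => 0 := coordFun_of_not F hi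
      have h2 : (l - i + 1 : ℂ) * (x 1 * coordFun F (i - 1) x) = 0 := by
        -- At `i = l + 1` the function with index `i - 1 = l` need not vanish, but the factor `l - i
        -- + 1` does.
        by_cases h : i = l + 1
        · rw [h]
          push_cast
          ring
        · rw [coordFun_of_not F (by omega)]
          simp
      rw [lieOp, h2, h1]
      simp [dz, dzConj, wirt]
    simp only [coordFun_of_not _ hi, h0, neg_zero]
    exact hasDerivAt_const _ _

end SiegelDiff

namespace SiegelDiff

open ComplexConjugate

/-! ### Differentiation with respect to a parameter -/

section parameter

variable {V : Type*} [NormedAddCommGroup V] [NormedSpace ℝ V]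

lemma fderiv_slice {H : ℝ × V → ℂ} {s : ℝ} {x : V} (h : DifferentiableAt ℝ H (s, x)) (u : V) :
    fderiv ℝ (fun y => H (s, y)) x u = fderiv ℝ H (s, x) (0, u) := by
  have h1 : HasFDerivAt (fun y => H (s, y)) _ x :=
    HasFDerivAt.comp x h.hasFDerivAt (hasFDerivAt_prodMk_right s x)
  rw [h1.fderiv]
  simp

lemma wirt_slice {U : Set V} (hU : IsOpen U) {H : ℝ × V → ℂ}
    (hH : ContDiffOn ℝ ∞ H (Set.univ ×ˢ U)) (u v : V) (c : ℂ) (s : ℝ) :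
    Set.EqOn (wirt u v c (fun y => H (s, y))) (fun y => wirt (0, u) (0, v) c H (s, y)) U := by
  intro x hx
  have h := differentiableAt_of_contDiffOn (isOpen_univ.prod hU) hH (x := (s, x)) ⟨trivial, hx⟩
  simp only [wirt, fderiv_slice h]

lemma wirt_iterate_slice {U : Set V} (hU : IsOpen U) {H : ℝ × V → ℂ}
    (hH : ContDiffOn ℝ ∞ H (Set.univ ×ˢ U)) (u v : V) (c : ℂ) (s : ℝ) (n : ℕ) :
    Set.EqOn ((wirt u v c)^[n] (fun y => H (s, y)))
      (fun y => (wirt (0, u) (0, v) c)^[n] H (s, y)) U := by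
  induction n with
  | zero => exact fun _ _ => rfl
  | succ n ih =>
    simp only [Function.iterate_succ_apply']
    exact (wirt_congr hU ih).trans
      (wirt_slice hU (contDiffOn_wirt_iterate (isOpen_univ.prod hU) hH n) u v c s)

end parameter

/-- `∂₁^p ∂₁₂^n ∂₂^q` on functions depending on an additional real parameter. -/
noncomputable def dzMonParam (p n q : ℕ) (H : ℝ × (Fin 3 → ℂ) → ℂ) : ℝ × (Fin 3 → ℂ) → ℂ :=
  (wirt (0, Pi.single 0 1) (0, Pi.single 0 Complex.I) (-Complex.I))^[p]
    ((wirt (0, Pi.single 1 1) (0, Pi.single 1 Complex.I) (-Complex.I))^[n]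
      ((wirt (0, Pi.single 2 1) (0, Pi.single 2 Complex.I) (-Complex.I))^[q] H))

section dzMonParam

variable {U : Set (Fin 3 → ℂ)} {H : ℝ × (Fin 3 → ℂ) → ℂ} {p n q : ℕ}

lemma contDiffOn_dzMonParam (hU : IsOpen U) (hH : ContDiffOn ℝ ∞ H (Set.univ ×ˢ U)) :
    ContDiffOn ℝ ∞ (dzMonParam p n q H) (Set.univ ×ˢ U) :=
  have hΩ := isOpen_univ.prod hU
  contDiffOn_wirt_iterate hΩ (contDiffOn_wirt_iterate hΩ (contDiffOn_wirt_iterate hΩ hH _) _) _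

lemma dzMon_slice (hU : IsOpen U) (hH : ContDiffOn ℝ ∞ H (Set.univ ×ˢ U)) (s : ℝ) :
    Set.EqOn (dzMon p n q (fun y => H (s, y))) (fun y => dzMonParam p n q H (s, y)) U := by
  have hΩ : IsOpen (Set.univ ×ˢ U : Set (ℝ × (Fin 3 → ℂ))) := isOpen_univ.prod hU
  simp only [dzMon, dz_eq_wirt]
  have h2 := contDiffOn_wirt_iterate (u := (0, Pi.single 2 1)) (v := (0, Pi.single 2 Complex.I))
    (c := -Complex.I) hΩ hH q
  have h1 := contDiffOn_wirt_iterate (u := (0, Pi.single 1 1)) (v := (0, Pi.single 1 Complex.I))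
    (c := -Complex.I) hΩ h2 n
  exact (wirt_iterate_congr hU ((wirt_iterate_congr hU (wirt_iterate_slice hU hH _ _ _ s q) n).trans
    (wirt_iterate_slice hU h2 _ _ _ s n)) p).trans (wirt_iterate_slice hU h1 _ _ _ s p)

lemma dzMonParam_wirt (hU : IsOpen U) (hH : ContDiffOn ℝ ∞ H (Set.univ ×ˢ U))
    {u v : ℝ × (Fin 3 → ℂ)} {c : ℂ} :
    Set.EqOn (dzMonParam p n q (wirt u v c H)) (wirt u v c (dzMonParam p n q H))
      (Set.univ ×ˢ U) := by
  have hΩ : IsOpen (Set.univ ×ˢ U : Set (ℝ × (Fin 3 → ℂ))) := isOpen_univ.prod hU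
  have h2 := contDiffOn_wirt_iterate (u := (0, Pi.single 2 1)) (v := (0, Pi.single 2 Complex.I))
    (c := -Complex.I) hΩ hH q
  have h1 := contDiffOn_wirt_iterate (u := (0, Pi.single 1 1)) (v := (0, Pi.single 1 Complex.I))
    (c := -Complex.I) hΩ h2 n
  exact (wirt_iterate_congr hΩ ((wirt_iterate_congr hΩ (wirt_iterate_comm hΩ hH q) n).trans
    (wirt_iterate_comm hΩ h2 n)) p).trans (wirt_iterate_comm hΩ h1 p)

/-- The derivative along a curve of the derivatives of a family of functions. -/
lemma hasDerivAt_dzMon_curve (hU : IsOpen U) (hH : ContDiffOn ℝ ∞ H (Set.univ ×ˢ U))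
    {g : (Fin 3 → ℂ) → ℂ} (hg : ∀ y ∈ U, HasDerivAt (fun s => H (s, y)) (g y) 0)
    {x : ℝ → Fin 3 → ℂ} {v : Fin 3 → ℂ} (hx : HasDerivAt x v 0) (hxU : ∀ s, x s ∈ U) :
    HasDerivAt (fun s => dzMon p n q (fun y => H (s, y)) (x s))
      (dzMon p n q g (x 0) + fderiv ℝ (dzMon p n q (fun y => H (0, y))) (x 0) v) 0 := by
  have hΩ : IsOpen (Set.univ ×ˢ U : Set (ℝ × (Fin 3 → ℂ))) := isOpen_univ.prod hU
  have hK := contDiffOn_dzMonParam (p := p) (n := n) (q := q) hU hH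
  have hd := differentiableAt_of_contDiffOn hΩ hK (x := (0, x 0)) ⟨trivial, hxU 0⟩
  have hc : HasDerivAt (fun s : ℝ => (s, x s)) ((1 : ℝ), v) 0 := (hasDerivAt_id 0).prodMk hx
  have h := hd.hasFDerivAt.comp_hasDerivAt (0 : ℝ) hc
  have e : (fun s => dzMon p n q (fun y => H (s, y)) (x s)) =
      (dzMonParam p n q H) ∘ fun s => (s, x s) :=
    funext fun s => dzMon_slice hU hH s (hxU s)
  rw [e]
  refine h.congr_deriv (Eq.symm ?_)
  have hsplit : ((1 : ℝ), v) = (1, 0) + (0, v) := by simp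
  rw [hsplit, map_add, ← fderiv_slice hd,
    (Filter.eventuallyEq_of_mem (hU.mem_nhds (hxU 0)) (dzMon_slice hU hH 0)).fderiv_eq]
  congr 1
  -- Writing `∂/∂s` as `(∂_s + ∂_s) / 2` puts it in the form `wirt`, so the commutation lemmas
  -- exchange it with `∂₁^p ∂₁₂^n ∂₂^q`.
  have hw : ∀ G : ℝ × (Fin 3 → ℂ) → ℂ, ∀ y, fderiv ℝ G y (1, 0) = wirt (1, 0) (1, 0) 1 G y := by
    intro G y
    rw [wirt]
    ring
  rw [hw, ← dzMonParam_wirt hU hH ⟨trivial, hxU 0⟩]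
  refine Eq.trans ?_ (dzMon_slice hU (contDiffOn_wirt hΩ hH) 0 (hxU 0))
  refine dzMon_congr hU (fun y hy => ?_) (hxU 0)
  rw [← hw]
  have h1 := (differentiableAt_of_contDiffOn hΩ hH (x := (0, y)) ⟨trivial, hy⟩).hasFDerivAt
  have h2 : HasDerivAt (fun s : ℝ => (s, y)) ((1 : ℝ), (0 : Fin 3 → ℂ)) 0 :=
    (hasDerivAt_id 0).prodMk (hasDerivAt_const _ _)
  exact (hg y hy).unique (h1.comp_hasDerivAt (0 : ℝ) h2)

end dzMonParam

lemma up_one : up 1 = 1 := by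
  refine Subtype.ext ?_
  change fromBlocks _ _ _ _ = (1 : Matrix _ _ ℝ)
  rw [← fromBlocks_one, fromBlocks_inj]
  refine ⟨?_, ?_, ?_, ?_⟩ <;> ext i j <;> fin_cases i <;> fin_cases j <;> simp

lemma slashM_one {k l : ℕ} (F : Matrix (Fin 2) (Fin 2) ℂ → HomPoly l) (Z : Matrix (Fin 2) (Fin 2) ℂ) :
    slashM k l F 1 Z = F Z := by
  have hb : (1 : symplecticGroup (Fin 2) ℝ).1 = fromBlocks 1 0 0 1 := fromBlocks_one.symm
  have h1 : denomM 1 Z = 1 := by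
    rw [denomM, hb, toBlocks_fromBlocks₂₁, toBlocks_fromBlocks₂₂]
    simp
  have h2 : numM 1 Z = Z := by
    rw [numM, hb, toBlocks_fromBlocks₁₁, toBlocks_fromBlocks₁₂]
    simp
  rw [slashM, actM, h1, h2]
  refine Subtype.ext ?_
  have h3 : substRow (1 : Matrix (Fin 2) (Fin 2) ℂ) = AlgHom.id ℂ _ := by
    refine MvPolynomial.algHom_ext fun j => ?_
    fin_cases j <;> simp [substRow, Fin.sum_univ_two]
  simp [symPow, h3]

/-! ### Infinitesimal equivariance in the first variable. -/

section key

variable {k r a b : ℕ} {c : ℕ → ℕ → ℕ → ℂ}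

lemma hasDerivAt_sumExp {T : ℝ → ℕ → ℕ → ℕ → ℂ} {T' : ℕ → ℕ → ℕ → ℂ}
    (h : ∀ p n q, HasDerivAt (fun s => T s p n q) (T' p n q) 0) :
    HasDerivAt (fun s => sumExp r (T s)) (sumExp r T') 0 :=
  HasDerivAt.fun_sum fun p _ => HasDerivAt.fun_sum fun n _ => HasDerivAt.fun_sum fun q _ => h p n q

/-- The infinitesimal equivariance. -/
lemma hasDerivAt_opSum_slashM (hc : ∀ p n q, p + n + q ≠ r → c p n q = 0)
    (hA : IsLoweringKernel k r a b c) {F : Matrix (Fin 2) (Fin 2) ℂ → HomPoly (a + b)}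
    (hF : IsSmooth F) {u v : ℂ} (hu : 0 < u.im) (hv : 0 < v.im) :
    HasDerivAt (fun s : ℝ => ((-s : ℝ) * u + 1 : ℂ)⁻¹ ^ (k + a + r) *
      opSum r a c (coordFun (slashM k (a + b) F (up (lowerUni s))))
        ![u / ((-s : ℝ) * u + 1), 0, v]) 0 0 := by
  have hneg := hasDerivAt_neg (0 : ℝ)
  have hfac : HasDerivAt (fun s : ℝ => ((-s : ℝ) * u + 1 : ℂ)⁻¹ ^ (k + a + r))
      ((k + a + r) * u) 0 := by
    have h := HasDerivAt.scomp (0 : ℝ) (h := fun s : ℝ => -s)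
      (by simpa using hasDerivAt_inv_autUp_pow u (k + a + r)) hneg
    simpa [Function.comp_def] using h
  -- The orbit `u / (1 - s u)` of `u` under `n_{-s}` has velocity `u²` at `s = 0`.
  have hcurve : HasDerivAt (fun s : ℝ => (![u / ((-s : ℝ) * u + 1), 0, v] : Fin 3 → ℂ))
      ![u ^ 2, 0, 0] 0 := by
    refine hasDerivAt_pi.2 fun i => ?_
    fin_cases i
    · have h := HasDerivAt.scomp (0 : ℝ) (h := fun s : ℝ => -s)
        (by simpa using (hasDerivAt_inv_autUp u).const_mul u) hneg
      simpa [Function.comp_def, div_eq_mul_inv, pow_two] using h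
    · simpa using hasDerivAt_const (0 : ℝ) (0 : ℂ)
    · simpa using hasDerivAt_const (0 : ℝ) v
  have hmem : ∀ s : ℝ, (![u / ((-s : ℝ) * u + 1), 0, v] : Fin 3 → ℂ) ∈ siegelCoord := by
    intro s
    have h := actUp_mem (lowerUni (-s)) (diag_mem_siegelCoord (z := (u, v)) ⟨hu, hv⟩)
    simpa [actUp_lowerUni] using h
  have hjoint : ∀ i, ContDiffOn ℝ ∞ (fun y : ℝ × (Fin 3 → ℂ) =>
      coordFun (slashM k (a + b) F (up (lowerUni y.1))) i y.2) (Set.univ ×ˢ siegelCoord) := by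
    intro i
    have h := coeffSmoothOn_slashM_up (k := k) (E := ℝ × (Fin 3 → ℂ))
      (U := Set.univ ×ˢ siegelCoord) (M := fun y => lowerUni y.1) (x := fun y => y.2) hF
      (fun i j => by
        refine ContDiff.contDiffOn ?_
        fin_cases i <;> fin_cases j <;> simp [lowerUni] <;> fun_prop)
      (fun i => ContDiff.contDiffOn (by fun_prop)) (fun y hy => hy.2)
    by_cases hi : 0 ≤ i ∧ i ≤ (a + b : ℕ)
    · exact (h _).congr fun y _ => if_pos hi
    · simp only [coordFun_of_not _ hi]
      exact contDiffOn_const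
  have h0 : ∀ i, (fun y => coordFun (slashM k (a + b) F (up (lowerUni 0))) i y) =
      coordFun F i := by
    intro i
    ext y
    simp only [coordFun, lowerUni_zero, up_one, slashM_one]
  have hx0 : (![u / ((-(0 : ℝ) : ℝ) * u + 1), 0, v] : Fin 3 → ℂ) = ![u, 0, v] := by simp
  have hterm : ∀ p n q i, HasDerivAt (fun s : ℝ => dzMon p n q
      (coordFun (slashM k (a + b) F (up (lowerUni s))) i) ![u / ((-s : ℝ) * u + 1), 0, v])
      (-dzMon p n q (lieOp k (a + b) (coordFun F) i) ![u, 0, v]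
        + (u ^ 2 * dz 0 (dzMon p n q (coordFun F i)) ![u, 0, v]
          + conj u ^ 2 * dzConj 0 (dzMon p n q (coordFun F i)) ![u, 0, v])) 0 := by
    intro p n q i
    have h := hasDerivAt_dzMon_curve (p := p) (n := n) (q := q) isOpen_siegelCoord (hjoint i)
      (fun y hy => hasDerivAt_coordFun_slashM hF hy i) hcurve hmem
    refine h.congr_deriv ?_
    dsimp only
    have hneg : dzMon p n q (fun y => -lieOp k (a + b) (coordFun F) i y) ![u, 0, v] =
        -dzMon p n q (lieOp k (a + b) (coordFun F) i) ![u, 0, v] := by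
      have h := dzMon_const_mul (p := p) (n := n) (q := q) isOpen_siegelCoord (-1)
        (contDiffOn_lieOp (k := k) (l := a + b) isOpen_siegelCoord hF.contDiffOn_coordFun i)
        (diag_mem_siegelCoord (z := (u, v)) ⟨hu, hv⟩)
      simpa using h
    rw [h0, hx0, hneg, fderiv_eq_sum_dz, Fin.sum_univ_three]
    simp only [Matrix.cons_val, map_zero, zero_mul, add_zero, map_pow]
  refine (hfac.fun_mul (hasDerivAt_sumExp (r := r)
    fun p n q => (hterm p n q (a + q - p)).const_mul (c p n q))).congr_deriv ?_
  -- The automorphy factor contributes `(k + a + r) u`, the moving point `u² ∂₁ + \bar u² ∂/∂\bar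
  -- z₁`, and the family `-lieOp`; these cancel by `opSum_lieOp`.
  have hL := opSum_lieOp hc hA isOpen_siegelCoord (hF.contDiffOn_coordFun)
    (diag_mem_siegelCoord (z := (u, v)) ⟨hu, hv⟩) rfl
  have hS : (sumExp r fun p n q => c p n q *
      (-dzMon p n q (lieOp k (a + b) (coordFun F) (a + q - p)) ![u, 0, v] +
        (u ^ 2 * dz 0 (dzMon p n q (coordFun F (a + q - p))) ![u, 0, v] +
          conj u ^ 2 * dzConj 0 (dzMon p n q (coordFun F (a + q - p))) ![u, 0, v]))) =
      -1 * opSum r a c (lieOp k (a + b) (coordFun F)) ![u, 0, v]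
      + (u ^ 2 * sumExp r (fun p n q =>
          c p n q * dz 0 (dzMon p n q (coordFun F (a + q - p))) ![u, 0, v])
      + conj u ^ 2 * sumExp r (fun p n q =>
          c p n q * dzConj 0 (dzMon p n q (coordFun F (a + q - p))) ![u, 0, v])) := by
    rw [opSum]
    simp only [mul_sumExp, ← sumExp_add]
    exact sumExp_congr fun p n q => by ring
  rw [hS, hL, hx0]
  simp only [lowerUni_zero, up_one, neg_zero, Complex.ofReal_zero, zero_mul, zero_add, inv_one,
    one_pow, one_mul, Matrix.cons_val, opSum]
  have h1 : slashM k (a + b) F 1 = F := funext fun Z => slashM_one F Z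
  rw [h1]
  ring

end key

end SiegelDiff

namespace SiegelDiff

/-! ### Equivariance in the first variable -/

lemma slash_apply_of_SL (f : ℍ → ℂ) (M : SL(2, ℝ)) (w : ℕ) (z : ℍ) :
    (f ∣[(w : ℤ)] (M : GL (Fin 2) ℝ)) z =
      (M 1 0 * (z : ℂ) + M 1 1 : ℂ)⁻¹ ^ w * f ((M : GL (Fin 2) ℝ) • z) := by
  rw [ModularForm.slash_apply]
  simp [UpperHalfPlane.σ, UpperHalfPlane.denom, mul_comm]

lemma coe_smul_of_SL (M : SL(2, ℝ)) (z : ℍ) :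
    (((M : GL (Fin 2) ℝ) • z : ℍ) : ℂ) =
      (M 0 0 * (z : ℂ) + M 0 1) / (M 1 0 * (z : ℂ) + M 1 1) := by
  rw [UpperHalfPlane.coe_smul]
  simp [UpperHalfPlane.σ, UpperHalfPlane.denom, UpperHalfPlane.num]

lemma slash_mul_of_SL (f : ℍ → ℂ) (M N : SL(2, ℝ)) (w : ℤ) :
    f ∣[w] ((M * N : SL(2, ℝ)) : GL (Fin 2) ℝ) =
      (f ∣[w] (M : GL (Fin 2) ℝ)) ∣[w] (N : GL (Fin 2) ℝ) := by
  rw [map_mul, SlashAction.slash_mul]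

lemma slash_one_of_SL (f : ℍ → ℂ) (w : ℤ) :
    f ∣[w] ((1 : SL(2, ℝ)) : GL (Fin 2) ℝ) = f := by
  rw [map_one, SlashAction.slash_one]

lemma opSum_congr {r a : ℕ} {c : ℕ → ℕ → ℕ → ℂ} {f g : ℤ → (Fin 3 → ℂ) → ℂ}
    (h : ∀ i, Set.EqOn (f i) (g i) siegelCoord) {x : Fin 3 → ℂ} (hx : x ∈ siegelCoord) :
    opSum r a c f x = opSum r a c g x :=
  sumExp_congr fun p n q => by rw [dzMon_congr isOpen_siegelCoord (h _) hx]

lemma coordFun_slashM_mul {k l : ℕ} (F : Matrix (Fin 2) (Fin 2) ℂ → HomPoly l)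
    {M N : symplecticGroup (Fin 2) ℝ} (hN : ActsOnSiegel N) (i : ℤ) :
    Set.EqOn (coordFun (slashM k l F (M * N)) i) (coordFun (slashM k l (slashM k l F M) N) i)
      siegelCoord := by
  intro x hx
  simp only [coordFun, slashM_mul F (hN _ hx).1]

lemma mem_of_upperHalfPlane (u v : ℍ) : (![(u : ℂ), 0, (v : ℂ)] : Fin 3 → ℂ) ∈ siegelCoord :=
  diag_mem_siegelCoord (z := ((u : ℂ), (v : ℂ))) ⟨u.im_pos, v.im_pos⟩

/-- Equivariance of the operator with coefficients `c` under `M↑`. -/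
def EquivariantUp (k l r a : ℕ) (c : ℕ → ℕ → ℕ → ℂ) (M : SL(2, ℝ)) : Prop :=
  ∀ F : Matrix (Fin 2) (Fin 2) ℂ → HomPoly l, IsSmooth F → ∀ v : ℍ,
    (fun u : ℍ => opSum r a c (coordFun (slashM k l F (up M))) ![(u : ℂ), 0, (v : ℂ)]) =
      (fun u : ℍ => opSum r a c (coordFun F) ![(u : ℂ), 0, (v : ℂ)])
        ∣[((k + a + r : ℕ) : ℤ)] (M : GL (Fin 2) ℝ)

/-! ### Unipotent subgroups and generation of `SL(2, ℝ)`. -/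

section generators

variable {k l r a b : ℕ} {c : ℕ → ℕ → ℕ → ℂ}

lemma opSum_slashM_up_mul (F : Matrix (Fin 2) (Fin 2) ℂ → HomPoly l) (M N : SL(2, ℝ)) (u v : ℍ) :
    opSum r a c (coordFun (slashM k l F (up (M * N)))) ![(u : ℂ), 0, (v : ℂ)] =
      opSum r a c (coordFun (slashM k l (slashM k l F (up M)) (up N))) ![(u : ℂ), 0, (v : ℂ)] := by
  rw [up_mul]
  exact opSum_congr (coordFun_slashM_mul F (actsOnSiegel_up N)) (mem_of_upperHalfPlane u v)

lemma EquivariantUp.mul {M N : SL(2, ℝ)} (hM : EquivariantUp k l r a c M)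
    (hN : EquivariantUp k l r a c N) : EquivariantUp k l r a c (M * N) := by
  intro F hF v
  rw [slash_mul_of_SL, ← hM F hF v, ← hN _ (hF.slashM_up M) v]
  exact funext fun u => opSum_slashM_up_mul F M N u v

/-- The function of `s` obtained by slashing the image of `F | n_s↑` with `n_{-s}` has derivative
zero, so it equals its value at `s = 0`; slashing with `n_s` gives the claim. -/
lemma equivariantUp_lowerUni (hl : l = a + b) (hc : ∀ p n q, p + n + q ≠ r → c p n q = 0)
    (hA : IsLoweringKernel k r a b c) (s : ℝ) : EquivariantUp k l r a c (lowerUni s) := by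
  subst hl
  intro F hF v
  set g : (Matrix (Fin 2) (Fin 2) ℂ → HomPoly (a + b)) → ℍ → ℂ :=
    fun F u => opSum r a c (coordFun F) ![(u : ℂ), 0, (v : ℂ)] with hg
  set w : ℤ := ((k + a + r : ℕ) : ℤ) with hw
  have hinf : ∀ G : Matrix (Fin 2) (Fin 2) ℂ → HomPoly (a + b), IsSmooth G → ∀ u : ℍ,
      HasDerivAt (fun t => (g (slashM k (a + b) G (up (lowerUni t)))
        ∣[w] (lowerUni (-t) : GL (Fin 2) ℝ)) u) 0 0 := by
    intro G hG u
    have h := hasDerivAt_opSum_slashM hc hA hG u.im_pos v.im_pos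
    convert h using 2 with t
    rw [slash_apply_of_SL, hg]
    simp only [coe_smul_of_SL]
    simp [lowerUni]
  have hder : ∀ z : ℍ, ∀ s, HasDerivAt (fun s => (g (slashM k (a + b) F (up (lowerUni s)))
      ∣[w] (lowerUni (-s) : GL (Fin 2) ℝ)) z) 0 s := by
    intro z s
    -- The group law moves the derivative from `0` to `s`: apply the infinitesimal statement to `F |
    -- n_s↑` at the point `n_{-s} z`, and multiply by the factor of `n_{-s}`, which does not depend
    -- on the new parameter `s' - s`.
    have h := (hinf (slashM k (a + b) F (up (lowerUni s))) (hF.slashM_up (lowerUni s))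
      ((lowerUni (-s) : GL (Fin 2) ℝ) • z)).const_mul
      ((lowerUni (-s) 1 0 * (z : ℂ) + lowerUni (-s) 1 1 : ℂ)⁻¹ ^ (k + a + r))
    rw [mul_zero, ← sub_self s] at h
    have h' := HasDerivAt.comp_sub_const s s h
    refine h'.congr_of_eventuallyEq (Filter.Eventually.of_forall fun s' => Eq.symm ?_)
    dsimp only
    rw [← slash_apply_of_SL, ← slash_mul_of_SL, ← lowerUni_add]
    have e : g (slashM k (a + b) (slashM k (a + b) F (up (lowerUni s))) (up (lowerUni (s' - s)))) =
        g (slashM k (a + b) F (up (lowerUni s'))) := by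
      funext u
      rw [show s' = s + (s' - s) by ring, lowerUni_add, add_sub_cancel]
      exact (opSum_slashM_up_mul F _ _ u v).symm
    rw [e, show -(s' - s) + -s = -s' by ring]
  have hconst : ∀ z : ℍ, (g (slashM k (a + b) F (up (lowerUni s)))
      ∣[w] (lowerUni (-s) : GL (Fin 2) ℝ)) z = g F z := by
    intro z
    have h := is_const_of_deriv_eq_zero (fun s => (hder z s).differentiableAt)
      (fun s => (hder z s).deriv) s 0
    rw [h, neg_zero, lowerUni_zero, slash_one_of_SL, up_one]
    have h1 : slashM k (a + b) F 1 = F := funext fun Z => slashM_one F Z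
    rw [h1]
  change g (slashM k (a + b) F (up (lowerUni s))) = g F ∣[w] (lowerUni s : GL (Fin 2) ℝ)
  rw [← funext hconst, ← slash_mul_of_SL, ← lowerUni_add, neg_add_cancel, lowerUni_zero,
    slash_one_of_SL]

/-- The upper triangular unipotent matrix with entry `t`. -/
def upperUni (t : ℝ) : SL(2, ℝ) := ⟨!![1, t; 0, 1], by simp [Matrix.det_fin_two]⟩

lemma wirt_comp_add_right {E : Type*} [NormedAddCommGroup E] [NormedSpace ℝ E] (u v e : E) (c : ℂ)
    (f : E → ℂ) (n : ℕ) :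
    (wirt u v c)^[n] (fun x => f (x + e)) = fun x => (wirt u v c)^[n] f (x + e) := by
  induction n with
  | zero => rfl
  | succ n ih =>
    simp only [Function.iterate_succ_apply']
    rw [ih]
    ext x
    simp only [wirt, fderiv_comp_add_right]

/-- Here the automorphy factor is 1 and the action is a translation, which commutes with
constant-coefficient operators. No condition on `c` is needed. -/
lemma equivariantUp_upperUni (t : ℝ) : EquivariantUp k l r a c (upperUni t) := by
  intro F hF v
  ext u
  have hco : ∀ i, Set.EqOn (coordFun (slashM k l F (up (upperUni t))) i)
      (fun x => coordFun F i (x + ![(t : ℂ), 0, 0])) siegelCoord := by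
    intro i x hx
    have ha : actUp (upperUni t) x = x + ![(t : ℂ), 0, 0] := by
      ext i
      fin_cases i <;> simp [actUp, upperUni]
    have hj : autUp (upperUni t) x = 1 := by simp [autUp, upperUni]
    have hz : (upperUni t 1 0 : ℝ) = 0 := rfl
    have h : (slashM k l F (up (upperUni t)) (symMat x)).1 =
        (F (symMat (x + ![(t : ℂ), 0, 0]))).1 := by
      rw [slashM_up F _ hx, homPoly_eq_sum (F (symMat (x + ![(t : ℂ), 0, 0])))]
      refine Finset.sum_congr rfl fun ij _ => ?_
      rw [ha, hj, hz]
      simp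
    simp only [coordFun, h]
  rw [slash_apply_of_SL, opSum_congr hco (mem_of_upperHalfPlane u v)]
  have hz : (upperUni t 1 0 : ℝ) = 0 := rfl
  have ho : (upperUni t 1 1 : ℝ) = 1 := rfl
  have hcoe : ((((upperUni t : SL(2, ℝ)) : GL (Fin 2) ℝ) • u : ℍ) : ℂ) = u + t := by
    rw [coe_smul_of_SL]
    simp [upperUni]
  have hx : (![(u : ℂ) + t, 0, (v : ℂ)] : Fin 3 → ℂ) = ![(u : ℂ), 0, (v : ℂ)] + ![(t : ℂ), 0, 0] := by
    simp
  rw [hz, ho, hcoe, hx]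
  simp only [Complex.ofReal_zero, zero_mul, zero_add, Complex.ofReal_one, inv_one, one_pow, one_mul]
  refine sumExp_congr fun p n q => ?_
  congr 1
  simp only [dzMon, dz_eq_wirt, wirt_comp_add_right]

/-- The big cell. A matrix with lower left entry zero is moved into it by `lowerUni 1`, so these
factors generate. -/
lemma eq_upperUni_mul {M : SL(2, ℝ)} (h : M 1 0 ≠ 0) :
    M = upperUni ((M 0 0 - 1) / M 1 0) * lowerUni (M 1 0) * upperUni ((M 1 1 - 1) / M 1 0) := by
  have hd := coe_det_eq_one M
  refine Subtype.ext ?_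
  change M.1 = !![1, (M 0 0 - 1) / M 1 0; 0, 1] * !![1, 0; M 1 0, 1] *
    !![1, (M 1 1 - 1) / M 1 0; 0, 1]
  ext i j
  fin_cases i <;> fin_cases j <;> simp [Matrix.mul_apply, Fin.sum_univ_two] <;> field_simp
  · ring
  · linear_combination -hd
  · ring

lemma equivariantUp (hl : l = a + b) (hc : ∀ p n q, p + n + q ≠ r → c p n q = 0)
    (hA : IsLoweringKernel k r a b c) (M : SL(2, ℝ)) : EquivariantUp k l r a c M := by
  have main : ∀ M : SL(2, ℝ), M 1 0 ≠ 0 → EquivariantUp k l r a c M := by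
    intro M h
    rw [eq_upperUni_mul h]
    exact ((equivariantUp_upperUni _).mul (equivariantUp_lowerUni hl hc hA _)).mul
      (equivariantUp_upperUni _)
  by_cases h : M 1 0 = 0
  · have hd := coe_det_eq_one M
    have h1 : (M * lowerUni 1) 1 0 ≠ 0 := by
      have e : (M * lowerUni 1) 1 0 = M 1 1 := by
        rw [Matrix.SpecialLinearGroup.coe_mul, Matrix.mul_apply, Fin.sum_univ_two, h]
        simp [lowerUni]
      rw [e]
      intro h0
      rw [h, h0] at hd
      simp at hd
    have e : M = M * lowerUni 1 * lowerUni (-1) := by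
      rw [mul_assoc, ← lowerUni_add, add_neg_cancel, lowerUni_zero, mul_one]
    rw [e]
    exact (main _ h1).mul (equivariantUp_lowerUni hl hc hA _)
  · exact main M h

end generators

end SiegelDiff

namespace SiegelDiff

/-! ### Equivariance in the second variable -/

section swap

variable {k l r a b : ℕ} {c : ℕ → ℕ → ℕ → ℂ}

/-- The interchange of the two diagonal coordinates. -/
noncomputable def revCoord : (Fin 3 → ℂ) ≃L[ℝ] (Fin 3 → ℂ) :=
  (LinearEquiv.funCongrLeft ℝ ℂ Fin.revPerm).toContinuousLinearEquiv

lemma revCoord_apply (x : Fin 3 → ℂ) (i : Fin 3) : revCoord x i = x i.rev := rfl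

lemma revCoord_eq (x : Fin 3 → ℂ) : revCoord x = ![x 2, x 1, x 0] := by
  ext i
  fin_cases i <;> rfl

lemma revCoord_single (j : Fin 3) (z : ℂ) :
    revCoord (Pi.single j z) = Pi.single j.rev z := by
  ext i
  rw [revCoord_apply, Pi.single_apply, Pi.single_apply]
  simp only [Fin.rev_eq_iff]

lemma revCoord_mem {x : Fin 3 → ℂ} (hx : x ∈ siegelCoord) : revCoord x ∈ siegelCoord := by
  rw [revCoord_eq]
  exact reverse_mem_siegelCoord hx

lemma dz_iterate_comp_revCoord (j : Fin 3) (f : (Fin 3 → ℂ) → ℂ) (n : ℕ) :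
    (dz j)^[n] (fun x => f (revCoord x)) = fun x => (dz j.rev)^[n] f (revCoord x) := by
  induction n with
  | zero => rfl
  | succ n ih =>
    simp only [Function.iterate_succ_apply']
    rw [ih]
    ext x
    have h := revCoord.comp_right_fderiv (f := (dz j.rev)^[n] f) (x := x)
    have e : (fun x => (dz j.rev)^[n] f (revCoord x)) = (dz j.rev)^[n] f ∘ revCoord := rfl
    simp only [dz, e, h, ContinuousLinearMap.comp_apply, ContinuousLinearEquiv.coe_coe,
      revCoord_single]

lemma dzMon_comp_revCoord {f : (Fin 3 → ℂ) → ℂ} (hf : ContDiffOn ℝ ∞ f siegelCoord) (p n q : ℕ)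
    {x : Fin 3 → ℂ} (hx : x ∈ siegelCoord) :
    dzMon p n q (fun x => f (revCoord x)) x = dzMon q n p f (revCoord x) := by
  have hU := isOpen_siegelCoord
  have e0 : (0 : Fin 3).rev = 2 := rfl
  have e1 : (1 : Fin 3).rev = 1 := rfl
  have e2 : (2 : Fin 3).rev = 0 := rfl
  have h : ∀ j m (g : (Fin 3 → ℂ) → ℂ), (dz j)^[m] (fun x => g (revCoord x)) =
      fun x => (dz j.rev)^[m] g (revCoord x) := fun j m g => dz_iterate_comp_revCoord j g m
  have h1 : dzMon p n q (fun x => f (revCoord x)) =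
      fun x => (dz 2)^[p] ((dz 1)^[n] ((dz 0)^[q] f)) (revCoord x) := by
    rw [dzMon, h, e2, h, e1, h, e0]
  rw [h1, dzMon]
  simp only [dz_eq_wirt]
  have hs := fun (j : Fin 3) m g (hg : ContDiffOn ℝ ∞ g siegelCoord) => contDiffOn_wirt_iterate
    (u := Pi.single j 1) (v := Pi.single j Complex.I) (c := -Complex.I) hU hg m
  -- Reversal also reverses the order of the three iterated derivatives; three exchanges restore the
  -- order fixed in `dzMon`.
  exact ((wirt_iterate_congr hU (wirt_iterate_comm_iterate hU hf n q) p).trans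
    ((wirt_iterate_comm_iterate hU (hs 1 n f hf) p q).trans
      (wirt_iterate_congr hU (wirt_iterate_comm_iterate hU hf p n) q))) (revCoord_mem hx)

lemma coeff_slashM_swapM (F : Matrix (Fin 2) (Fin 2) ℂ → HomPoly l) (x : Fin 3 → ℂ) {i j : ℕ}
    (h : i + j = l) : coeff (bideg i j) (slashM k l F swapM (symMat x)).1 =
      (-1) ^ k * coeff (bideg j i) (F (symMat (revCoord x))).1 := by
  have e : (slashM k l F swapM (symMat x)).1 =
      C ((-1) ^ k) * substRow !![0, 1; 1, 0] (F (symMat (revCoord x))).1 := by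
    rw [slashM, denomM_swapM, actM_swapM, inv_swap, revCoord_eq, ← smul_eq_C_mul]
    have hd : (!![0, 1; 1, 0] : Matrix (Fin 2) (Fin 2) ℂ).det = -1 := by simp
    rw [hd, ← inv_pow, inv_neg_one]
    rfl
  rw [e, coeff_C_mul, homPoly_eq_sum (F (symMat (revCoord x))), map_sum, coeff_sum,
    coeff_bideg_sum (fun ij : ℕ × ℕ => coeff (bideg ij.1 ij.2) (F (symMat (revCoord x))).1)
      (by omega : j + i = l), Finset.sum_eq_single (j, i)]
  · rw [substRow_mul_pow]
    simp only [Matrix.of_apply, Matrix.cons_val', Matrix.cons_val, C_0, C_1, mul_zero, mul_one,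
      zero_add, add_zero]
    rw [mul_comm (X 1 ^ j), coeff_bideg_mul, if_pos ⟨rfl, rfl⟩]
  · rintro ⟨i', j'⟩ _ hne
    rw [substRow_mul_pow]
    simp only [Matrix.of_apply, Matrix.cons_val', Matrix.cons_val, C_0, C_1, mul_zero, mul_one,
      zero_add, add_zero]
    rw [mul_comm (X 1 ^ i'), coeff_bideg_mul, if_neg]
    rintro ⟨rfl, rfl⟩
    exact hne rfl
  · intro hn
    exact absurd (Finset.HasAntidiagonal.mem_antidiagonal.2 (by simp only; omega)) hn

lemma coordFun_slashM_swapM (F : Matrix (Fin 2) (Fin 2) ℂ → HomPoly l) (i : ℤ) :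
    coordFun (slashM k l F swapM) i = fun x => (-1) ^ k * coordFun F (l - i) (revCoord x) := by
  by_cases hi : 0 ≤ i ∧ i ≤ l
  · obtain ⟨i, rfl⟩ := Int.eq_ofNat_of_zero_le hi.1
    obtain ⟨j, hj⟩ := Nat.exists_eq_add_of_le (Int.ofNat_le.1 hi.2)
    have hji : (l - i : ℤ) = (j : ℕ) := by omega
    rw [hji, coordFun_of_add_eq _ hj.symm, coordFun_of_add_eq F (by omega : j + i = l)]
    exact funext fun x => coeff_slashM_swapM F x hj.symm
  · rw [coordFun_of_not _ hi, coordFun_of_not F (by omega)]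
    simp

lemma contDiffOn_comp_revCoord {f : (Fin 3 → ℂ) → ℂ} (hf : ContDiffOn ℝ ∞ f siegelCoord) :
    ContDiffOn ℝ ∞ (fun x => f (revCoord x)) siegelCoord :=
  hf.comp revCoord.contDiff.contDiffOn fun _ hx => revCoord_mem hx

lemma IsSmooth.slashM_swapM {F : Matrix (Fin 2) (Fin 2) ℂ → HomPoly l} (hF : IsSmooth F) :
    IsSmooth (slashM k l F swapM) := by
  intro n
  by_cases h : n 0 + n 1 = l
  · rw [eq_bideg n]
    simp only [coeff_slashM_swapM F _ h]
    exact contDiffOn_const.mul (contDiffOn_comp_revCoord (hF _))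
  · simp only [coeff_eq_zero_of_homPoly _ h]
    exact contDiffOn_const

/-- The swap sends the coefficient index `i` to `l - i`, and `l - (a + p - q) = b + q - p` is the
index belonging to the operator with `a`, `b` and `p`, `q` exchanged. -/
lemma opSum_slashM_swapM (hl : l = a + b) {F : Matrix (Fin 2) (Fin 2) ℂ → HomPoly l}
    (hF : IsSmooth F) {x : Fin 3 → ℂ} (hx : x ∈ siegelCoord) :
    opSum r a c (coordFun (slashM k l F swapM)) x =
      (-1) ^ k * opSum r b (fun p n q => c q n p) (coordFun F) (revCoord x) := by
  rw [opSum, opSum, sumExp_swap, mul_sumExp]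
  refine sumExp_congr fun p n q => ?_
  rw [coordFun_slashM_swapM, dzMon_const_mul isOpen_siegelCoord _
    (contDiffOn_comp_revCoord (hF.contDiffOn_coordFun _)) hx,
    dzMon_comp_revCoord (hF.contDiffOn_coordFun _) _ _ _ hx,
    show (l - (a + p - q) : ℤ) = b + q - p by rw [hl]; push_cast; ring]
  ring

/-- Equivariance under `M↓`. -/
lemma opSum_slashM_down (hl : l = a + b) (hc : ∀ p n q, p + n + q ≠ r → c p n q = 0)
    (hB : IsLoweringKernel k r b a fun p n q => c q n p)
    {F : Matrix (Fin 2) (Fin 2) ℂ → HomPoly l} (hF : IsSmooth F) (M : SL(2, ℝ)) (u : ℍ) :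
    (fun v : ℍ => opSum r a c (coordFun (slashM k l F (down M))) ![(u : ℂ), 0, (v : ℂ)]) =
      (fun v : ℍ => opSum r a c (coordFun F) ![(u : ℂ), 0, (v : ℂ)])
        ∣[((k + b + r : ℕ) : ℤ)] (M : GL (Fin 2) ℝ) := by
  have hl' : l = b + a := by omega
  have hrev : ∀ u v : ℍ, revCoord ![(u : ℂ), 0, (v : ℂ)] = ![(v : ℂ), 0, (u : ℂ)] := fun u v => by
    rw [revCoord_eq]
    rfl
  have hsw := hF.slashM_swapM (k := k)
  have h := equivariantUp hl' (fun p n q hr => hc q n p (by omega)) hB M _ hsw u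
  ext v
  have hv := congrFun h v
  rw [slash_apply_of_SL] at hv ⊢
  rw [opSum_slashM_swapM (c := fun p n q => c q n p) hl' hF (mem_of_upperHalfPlane _ _), hrev] at hv
  have hmem := mem_of_upperHalfPlane u v
  rw [down_eq, mul_assoc,
    opSum_congr (coordFun_slashM_mul F ((actsOnSiegel_up M).mul actsOnSiegel_swapM)) hmem,
    opSum_congr (coordFun_slashM_mul _ actsOnSiegel_swapM) hmem,
    opSum_slashM_swapM hl (hsw.slashM_up M) hmem, hrev, hv]
  -- The swap matrix has determinant -1; the two signs from conjugating by it cancel.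
  have hsq : ((-1 : ℂ) ^ k) * (-1) ^ k = 1 := by rw [← mul_pow]; simp
  linear_combination (M 1 0 * (v : ℂ) + M 1 1 : ℂ)⁻¹ ^ (k + b + r) *
    opSum r a c (coordFun F) ![(u : ℂ), 0, (((M : GL (Fin 2) ℝ) • v : ℍ) : ℂ)] * hsq

end swap

end SiegelDiff

namespace SiegelDiff

/-! ### Regularity and nonvanishing -/

section regularity

variable {r a b l : ℕ} {c : ℕ → ℕ → ℕ → ℂ}

lemma mapsTo_diag : Set.MapsTo (fun z : ℂ × ℂ => (![z.1, 0, z.2] : Fin 3 → ℂ)) halfPlaneProd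
    siegelCoord := fun _ hz => diag_mem_siegelCoord hz

lemma contDiff_diag : ContDiff ℝ ∞ (fun z : ℂ × ℂ => (![z.1, 0, z.2] : Fin 3 → ℂ)) :=
  contDiff_pi.2 fun i => by fin_cases i <;> simp <;> fun_prop

lemma differentiable_diag : Differentiable ℂ (fun z : ℂ × ℂ => (![z.1, 0, z.2] : Fin 3 → ℂ)) :=
  differentiable_pi.2 fun i => by fin_cases i <;> simp

lemma contDiffOn_opSum {f : ℤ → (Fin 3 → ℂ) → ℂ} (hf : ∀ i, ContDiffOn ℝ ∞ (f i) siegelCoord) :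
    ContDiffOn ℝ ∞ (opSum r a c f) siegelCoord := by
  unfold opSum sumExp
  exact ContDiffOn.sum fun _ _ => ContDiffOn.sum fun _ _ => ContDiffOn.sum fun _ _ =>
    contDiffOn_const.mul (contDiffOn_dzMon isOpen_siegelCoord (hf _))

lemma differentiableOn_dz {U : Set (Fin 3 → ℂ)} (hU : IsOpen U) {f : (Fin 3 → ℂ) → ℂ}
    (hf : DifferentiableOn ℂ f U) (j : Fin 3) : DifferentiableOn ℂ (dz j f) U := by
  refine (differentiableOn_fderiv_apply hU hf (Pi.single j 1)).congr fun x hx => ?_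
  have h := (hf.differentiableAt (hU.mem_nhds hx)).fderiv_restrictScalars ℝ
  have hI : (Pi.single j Complex.I : Fin 3 → ℂ) = Complex.I • Pi.single j 1 := by
    rw [← Pi.single_smul]
    simp
  rw [dz, h, ContinuousLinearMap.coe_restrictScalars', hI, map_smul, smul_eq_mul, ← mul_assoc,
    Complex.I_mul_I]
  ring

lemma differentiableOn_dzMon {U : Set (Fin 3 → ℂ)} (hU : IsOpen U) {f : (Fin 3 → ℂ) → ℂ}
    (hf : DifferentiableOn ℂ f U) (p n q : ℕ) : DifferentiableOn ℂ (dzMon p n q f) U := by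
  have h : ∀ j m (g : (Fin 3 → ℂ) → ℂ), DifferentiableOn ℂ g U →
      DifferentiableOn ℂ ((dz j)^[m] g) U := by
    intro j m g hg
    induction m with
    | zero => exact hg
    | succ m ih =>
      rw [Function.iterate_succ_apply']
      exact differentiableOn_dz hU ih j
  exact h _ _ _ (h _ _ _ (h _ _ _ hf))

lemma IsHolomorphic.differentiableOn_coordFun {F : Matrix (Fin 2) (Fin 2) ℂ → HomPoly l}
    (hF : IsHolomorphic F) (i : ℤ) : DifferentiableOn ℂ (coordFun F i) siegelCoord := by
  by_cases h : 0 ≤ i ∧ i ≤ l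
  · exact (hF _).congr fun x _ => if_pos h
  · rw [coordFun_of_not F h]
    exact differentiableOn_const _

lemma differentiableOn_opSum {f : ℤ → (Fin 3 → ℂ) → ℂ}
    (hf : ∀ i, DifferentiableOn ℂ (f i) siegelCoord) :
    DifferentiableOn ℂ (opSum r a c f) siegelCoord := by
  unfold opSum sumExp
  exact DifferentiableOn.fun_sum fun _ _ => DifferentiableOn.fun_sum fun _ _ =>
    DifferentiableOn.fun_sum fun _ _ =>
      (differentiableOn_const _).fun_mul (differentiableOn_dzMon isOpen_siegelCoord (hf _) _ _ _)

/-- The function `z₁₂ ^ r * X₁ ^ a * X₂ ^ b`. -/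
noncomputable def offDiagPow (r a b : ℕ) (Z : Matrix (Fin 2) (Fin 2) ℂ) : HomPoly (a + b) :=
  ⟨C (Z 0 1 ^ r) * (X 0 ^ a * X 1 ^ b), by
    rw [C_mul_X_pow_mul_X_pow, mem_homogeneousSubmodule]
    exact isHomogeneous_monomial _ (by simp [bideg, Finsupp.degree_eq_sum, Fin.sum_univ_two])⟩

lemma coeff_offDiagPow (n : Fin 2 →₀ ℕ) (x : Fin 3 → ℂ) :
    coeff n (offDiagPow r a b (symMat x)).1 = if bideg a b = n then x 1 ^ r else 0 := by
  have e : (offDiagPow r a b (symMat x)).1 = C (x 1 ^ r) * (X 0 ^ a * X 1 ^ b) := rfl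
  rw [e, C_mul_X_pow_mul_X_pow, coeff_monomial]

lemma isHolomorphic_offDiagPow : IsHolomorphic (offDiagPow r a b) := by
  intro n
  simp only [coeff_offDiagPow]
  split_ifs
  · fun_prop
  · exact differentiableOn_const _

lemma coordFun_offDiagPow (i : ℤ) :
    coordFun (offDiagPow r a b) i = fun x => if i = a then x 1 ^ r else 0 := by
  by_cases hi : 0 ≤ i ∧ i ≤ (a + b : ℕ)
  · obtain ⟨i, rfl⟩ := Int.eq_ofNat_of_zero_le hi.1
    obtain ⟨j, hj⟩ := Nat.exists_eq_add_of_le (Int.ofNat_le.1 hi.2)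
    rw [coordFun_of_add_eq _ hj.symm]
    ext x
    rw [coeff_offDiagPow]
    refine if_congr ?_ rfl rfl
    rw [bideg_inj]
    omega
  · rw [coordFun_of_not _ hi]
    ext x
    rw [if_neg (by omega)]

lemma dz_iterate_const (j : Fin 3) (d : ℂ) (m : ℕ) :
    (dz j)^[m] (fun _ => d) = fun _ => if m = 0 then d else 0 := by
  induction m with
  | zero => simp
  | succ m ih =>
    rw [Function.iterate_succ_apply', ih]
    ext x
    simp [dz]

lemma dzMon_coord_one_pow {x : Fin 3 → ℂ} (hx : x 1 = 0) (p n q m : ℕ) :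
    dzMon p n q (fun x => x 1 ^ m) x = if p = 0 ∧ n = m ∧ q = 0 then (m.factorial : ℂ) else 0 := by
  induction m generalizing n with
  | zero =>
    simp only [pow_zero, dzMon, dz_iterate_const]
    split_ifs <;> simp_all
  | succ m ih =>
    have h := dzMon_coord_one_mul (p := p) (n := n) (q := q) (g := fun x : Fin 3 → ℂ => x 1 ^ m)
      isOpen_univ ((contDiff_coord 1).pow m).contDiffOn (Set.mem_univ x)
    simp only [pow_succ']
    rw [h, hx, zero_mul, zero_add, ih]
    cases n with
    | zero => simp
    | succ n =>
      simp only [Nat.add_sub_cancel, Nat.add_right_cancel_iff, Nat.factorial_succ]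
      split_ifs with h1
      · rw [h1.2.1]
        push_cast
        ring
      · simp

/-- At `x 1 = 0` only `∂₁₂^r` sees `z₁₂^r`, which forces `p = q = 0` and hence the single nonzero
component `i = a`. -/
lemma opSum_offDiagPow {x : Fin 3 → ℂ} (hx : x 1 = 0) :
    opSum r a c (coordFun (offDiagPow r a b)) x = c 0 r 0 * r.factorial := by
  have hterm : ∀ p n q, c p n q * dzMon p n q (coordFun (offDiagPow r a b) (a + q - p)) x =
      if p = 0 ∧ n = r ∧ q = 0 then c 0 r 0 * r.factorial else 0 := by
    intro p n q
    rw [coordFun_offDiagPow]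
    by_cases h : (a + q - p : ℤ) = a
    · simp only [if_pos h]
      rw [dzMon_coord_one_pow hx]
      split_ifs with h1
      · rw [h1.1, h1.2.1, h1.2.2]
      · simp
    · simp only [if_neg h, dzMon_zero, mul_zero]
      rw [if_neg]
      omega
  rw [opSum, sumExp_congr hterm, sumExp, Finset.sum_eq_single 0, Finset.sum_eq_single r,
    Finset.sum_eq_single 0]
  · simp
  all_goals simp +contextual

end regularity

end SiegelDiff

open SiegelDiff in
theorem proposition2p7 (k r l a b : ℕ) (hk : 2 ≤ k) (hl : l = a + b) :
    ∃ P : MvPolynomial (Fin 3) ℂ,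
      P.IsHomogeneous r ∧
      -- the operator is not zero
      (∃ F : Matrix (Fin 2) (Fin 2) ℂ → SiegelDiff.HomPoly l, SiegelDiff.IsHolomorphic F ∧
        ∃ z ∈ SiegelDiff.halfPlaneProd, SiegelDiff.diagOp r a b P F z ≠ 0) ∧
      -- it maps smooth functions to smooth functions and holomorphic ones to holomorphic ones
      (∀ F : Matrix (Fin 2) (Fin 2) ℂ → SiegelDiff.HomPoly l, SiegelDiff.IsSmooth F →
        ContDiffOn ℝ ∞ (SiegelDiff.diagOp r a b P F) SiegelDiff.halfPlaneProd) ∧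
      (∀ F : Matrix (Fin 2) (Fin 2) ℂ → SiegelDiff.HomPoly l, SiegelDiff.IsHolomorphic F →
        DifferentiableOn ℂ (SiegelDiff.diagOp r a b P F) SiegelDiff.halfPlaneProd) ∧
      -- it is equivariant
      (∀ F : Matrix (Fin 2) (Fin 2) ℂ → SiegelDiff.HomPoly l, SiegelDiff.IsSmooth F →
        ∀ M₁ M₂ : SL(2, ℝ),
          SiegelDiff.resHH (SiegelDiff.diagOp r a b P
              (SiegelDiff.slashM k l F (SiegelDiff.up M₁ * SiegelDiff.down M₂))) =
            SiegelDiff.slashSnd (k + b + r)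
              (SiegelDiff.slashFst (k + a + r)
                (SiegelDiff.resHH (SiegelDiff.diagOp r a b P F)) M₁) M₂) := by
  have hc : ∀ p n q, p + n + q ≠ r → opCoef k r a b p n q = 0 := fun _ _ _ => opCoef_eq_zero
  have hdiag : ∀ F : Matrix (Fin 2) (Fin 2) ℂ → HomPoly l,
      diagOp r a b (triPoly r (opCoef k r a b)) F =
        fun z => opSum r a (opCoef k r a b) (coordFun F) ![z.1, 0, z.2] :=
    fun F => funext fun z => diagOp_triPoly hl hc F z
  refine ⟨triPoly r (opCoef k r a b), isHomogeneous_triPoly hc, ?_, ?_, ?_, ?_⟩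
  · subst hl
    refine ⟨offDiagPow r a b, isHolomorphic_offDiagPow, (Complex.I, Complex.I), by
      simp [halfPlaneProd], ?_⟩
    rw [hdiag]
    dsimp only
    rw [opSum_offDiagPow rfl, opCoef_zero_zero, one_mul]
    exact_mod_cast r.factorial_ne_zero
  · intro F hF
    rw [hdiag]
    exact (contDiffOn_opSum hF.contDiffOn_coordFun).comp contDiff_diag.contDiffOn mapsTo_diag
  · intro F hF
    rw [hdiag]
    exact (differentiableOn_opSum hF.differentiableOn_coordFun).comp
      differentiable_diag.differentiableOn mapsTo_diag
  · intro F hF M₁ M₂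
    ext ⟨u, v⟩
    have hdown : ActsOnSiegel (down M₂) := by
      rw [down_eq]
      exact (actsOnSiegel_swapM.mul (actsOnSiegel_up M₂)).mul actsOnSiegel_swapM
    -- Apply `M₂↓` to the smooth function `F | M₁↑`, then rewrite the image of that function for
    -- every `v`, because the slash in the second variable evaluates it at the moved point.
    have h2 := congrFun (opSum_slashM_down hl hc (isLoweringKernel_opCoef_symm hk)
      (hF.slashM_up (k := k) M₁) M₂ u) v
    have h1 := fun v => congrFun (equivariantUp hl hc (isLoweringKernel_opCoef hk) M₁ F hF v) u
    simp only [h1] at h2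
    simp only [hdiag, resHH, slashSnd, slashFst]
    rw [opSum_congr (coordFun_slashM_mul F hdown) (mem_of_upperHalfPlane u v)]
    exact h2
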